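/- Let $d>2$, $\hbar,m>0$, $\lambda>0$, $g_0>0$, $\varepsilon_0<0$, and let $\Lambda\subset\mathbb R^d$ be the cube of side $L$ and volume $V=L^d$ with periodic boundary conditions, with dual lattice $\Lambda^*=\frac{2\pi}{L}\mathbb Z^d$. On the boson Fock space $\mathcal F_\Lambda$ over $L^2(\Lambda)$ let $a_k^{*},a_k$ $(k\in\Lambda^*)$ be the creation and annihilation operators of the plane-wave modes, $N_k=a_k^*a_k$, $N_\Lambda=\sum_{k\in\Lambda^*}N_k$, and $\varepsilon_k=\hbar^2|k|^2/2m$ for $k\ne0$. For $g>0$ the toy model is $$H_\Lambda=\sum_{k\in\Lambda^*\setminus\{0\}}\varepsilon_kN_k+\varepsilon_0N_0+\frac{g_0}{2V}N_0^2+\frac{\lambda}{2V}N_\Lambda^2+\frac{g}{2V}\sum_{k\in\Lambda^*\setminus\{0\}}N_k^2 .$$ For a Hamiltonian $H$, temperature $\theta=\beta^{-1}\ge0$ and $\mu\in\mathbb R$, its grand-canonical pressure is $\frac1{\beta V}\ln\operatorname{Tr}_{\mathcal F_\Lambda}e^{-\beta(H-\mu N_\Lambda)}$ if $\theta>0$,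 and the corresponding limit $-\frac1V\inf\operatorname{spec}(H-\mu N_\Lambda)$ as $\beta\to\infty$ if $\theta=0$. Write $p_\Lambda(\beta,\mu)$ for the pressure of $H_\Lambda$. For $\theta\ge 0$ and $\alpha\le0$ put $$p^{BZ}(\beta,\alpha)=p^P(\beta,\alpha)-\inf_{\rho_0\ge0}\Big[(\varepsilon_0-\alpha)\rho_0+\frac{g_0\rho_0^2}{2}\Big],\qquad p^P(\beta,\alpha)=\frac1{\beta(2\pi)^d}\int_{\mathbb R^d}\ln\Big[\big(1-e^{-\beta(\hbar^2|k|^2/2m-\alpha)}\big)^{-1}\Big]d^dk,$$ with $p^P=0$ if $\theta=0$. This $p^{BZ}$ is the thermodynamic limit $V\to\infty$, for all $\theta\ge0$ and $\alpha\le 0$, of the grand-canonical pressure of $$H^{BZ}_\Lambda=\sum_{k\ne0}\varepsilon_ka_k^*a_k+\varepsilon_0a_0^*a_0+\frac{g_0}{2V}a_0^*a_0^*a_0a_0+\frac1V\sum_{k\ne0}g_k(V)a_k^*a_k^*a_ka_k,$$ for every choice of couplings with $0<g_-\le g_k(V)\le\gamma_kV^{\alpha_k}$ for all large $V$, where $\alpha_k\le\alpha_+<1$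 and $0<\gamma_k\le\gamma_+$. Moreover, for every $g>0$: (i) $H_\Lambda$ is superstable: $H_\Lambda\ge-BN_\Lambda+\frac CVN_\Lambda^2$ as quadratic forms for every cube $\Lambda$, with $B=-\varepsilon_0$ and $C=\lambda/2$; and the domain of stability, that is, the set of $(\theta,\mu)$ with $\theta\ge0$, $\mu\in\mathbb R$ for which $\lim_{V\to\infty}p_\Lambda(\beta,\mu)$ exists and is $<+\infty$, is all of $\{\theta\ge0\}\times\{\mu\in\mathbb R\}$. (ii) For all $\theta\ge0$ and $\mu\in\mathbb R$ the limit is finite and $$p(\beta,\mu):=\lim_{V\to\infty}p_\Lambda(\beta,\mu)=\inf_{\alpha\le0}\Big\{p^{BZ}(\beta,\alpha)+\frac{(\mu-\alpha)^2}{2\lambda}\Big\};$$ in particular $p(\beta,\mu)$ does not depend on $g>0$. -/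

import Mathlib

noncomputable section

namespace BoseToy

/-- Label `n ∈ ℤ^d` of the one-particle plane-wave mode with momentum `k = 2πn/L` of the periodic
cube of side `L`; the mode `k = 0` is the label `0`. -/
abbrev Mode (d : ℕ) : Type := Fin d → ℤ

/-- Occupation numbers: finitely many bosons distributed over the modes. -/
abbrev Occ (d : ℕ) : Type := Mode d →₀ ℕ

/-- The boson Fock space over `L²` of the periodic cube, in its occupation-number representation:
the occupation states of the plane waves form an orthonormal basis. -/
abbrev Fock (d : ℕ) : Type := lp (fun _ : Occ d => ℂ) 2

/-- The dense subspace of finite linear combinations of occupation states, the common invariant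
domain of all the (unbounded) operators below. -/
abbrev Core (d : ℕ) : Type := Occ d →₀ ℂ

/-- The occupation state `|n⟩`, as a vector of the core. -/
def ket {d : ℕ} (n : Occ d) : Core d := Finsupp.single n 1

/-- The inclusion of the core in the Fock space. -/
def toFock (d : ℕ) : Core d →ₗ[ℂ] Fock d :=
  Finsupp.linearCombination ℂ (fun n : Occ d => lp.single 2 n (1 : ℂ))

/-- Operators on the core. -/
abbrev Op (d : ℕ) : Type := Module.End ℂ (Core d)

/-- The annihilation operator: `a_k |n⟩ = √(n_k) |n - 1_k⟩`. -/
def annihilate {d : ℕ} (k : Mode d) : Op d :=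
  Finsupp.linearCombination ℂ
    (fun n : Occ d => ((Real.sqrt (n k) : ℝ) : ℂ) • ket (n - Finsupp.single k 1))

/-- The creation operator: `a_k^* |n⟩ = √(n_k + 1) |n + 1_k⟩`. -/
def create {d : ℕ} (k : Mode d) : Op d :=
  Finsupp.linearCombination ℂ
    (fun n : Occ d => ((Real.sqrt (n k + 1) : ℝ) : ℂ) • ket (n + Finsupp.single k 1))

/-- The occupation number operator `N_k = a_k^* a_k`. -/
def number {d : ℕ} (k : Mode d) : Op d := create k * annihilate k

/-- The sum `∑_{k ∈ s} A_k` of mode operators, linearly extended from the occupation states. For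
the operators used below only finitely many terms are nonzero on each occupation state. -/
def modeSum {d : ℕ} (s : Set (Mode d)) (A : Mode d → Op d) : Op d :=
  Finsupp.linearCombination ℂ (fun n : Occ d => ∑ᶠ k ∈ s, A k (ket n))

/-- The total particle number operator `N_Λ = ∑_k N_k`. -/
def totalNumber (d : ℕ) : Op d := modeSum Set.univ number

/-- The momentum `k = 2πn/L`. -/
def momentum {d : ℕ} (L : ℝ) (n : Mode d) : EuclideanSpace ℝ (Fin d) :=
  WithLp.toLp 2 (fun i => 2 * Real.pi * (n i : ℝ) / L)

/-- The one-particle kinetic energy `ħ²|k|²/2m`. -/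
def kinetic {d : ℕ} (hbar m : ℝ) (k : EuclideanSpace ℝ (Fin d)) : ℝ :=
  hbar ^ 2 * ‖k‖ ^ 2 / (2 * m)

/-- The toy Hamiltonian in the cube of side `L` and volume `V = L^d`:
`∑_{k ≠ 0} ε_k a_k^* a_k + ε₀ a_0^* a_0 + (g₀/2V) N_0² + (lam/2V) N_Λ² + (g/2V) ∑_{k ≠ 0} N_k²`. -/
def toyHamiltonian (d : ℕ) (hbar m ε₀ g₀ lam g L : ℝ) : Op d :=
  modeSum {0}ᶜ (fun k => ((kinetic hbar m (momentum L k) : ℝ) : ℂ) • number k)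
    + (ε₀ : ℂ) • number 0
    + ((g₀ / (2 * L ^ d) : ℝ) : ℂ) • number 0 ^ 2
    + ((lam / (2 * L ^ d) : ℝ) : ℂ) • totalNumber d ^ 2
    + ((g / (2 * L ^ d) : ℝ) : ℂ) • modeSum {0}ᶜ (fun k => number k ^ 2)

/-- The Hamiltonian `H^BZ` in the cube of side `L` and volume `V = L^d`:
`∑_{k ≠ 0} ε_k a_k^* a_k + ε₀ a_0^* a_0 + (g₀/2V) a_0^* a_0^* a_0 a_0
  + (1/V) ∑_{k ≠ 0} g_k(V) a_k^* a_k^* a_k a_k`. -/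
def bzHamiltonian (d : ℕ) (hbar m ε₀ g₀ : ℝ) (gk : Mode d → ℝ → ℝ) (L : ℝ) : Op d :=
  modeSum {0}ᶜ (fun k => ((kinetic hbar m (momentum L k) : ℝ) : ℂ) • number k)
    + (ε₀ : ℂ) • number 0
    + ((g₀ / (2 * L ^ d) : ℝ) : ℂ) • (create 0 * create 0 * annihilate 0 * annihilate 0)
    + ((1 / L ^ d : ℝ) : ℂ) • modeSum {0}ᶜ
        (fun k => ((gk k (L ^ d) : ℝ) : ℂ) • (create k * create k * annihilate k * annihilate k))

/-- The admissible couplings of `H^BZ`: `0 < g₋ ≤ g_k(V) ≤ γ_k V^{α_k}` for `k ≠ 0` and all large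
volumes `V`, with `α_k ≤ α₊ < 1` and `0 < γ_k ≤ γ₊`. -/
def AdmissibleCouplings {d : ℕ} (gk : Mode d → ℝ → ℝ) : Prop :=
  ∃ (gminus γplus αplus V₀ : ℝ) (γ α : Mode d → ℝ), 0 < gminus ∧ αplus < 1 ∧ 0 < V₀ ∧
    ∀ k, k ≠ 0 → 0 < γ k ∧ γ k ≤ γplus ∧ α k ≤ αplus ∧
      ∀ V : ℝ, V₀ ≤ V → gminus ≤ gk k V ∧ gk k V ≤ γ k * V ^ α k

/-- The quadratic form `⟨ψ, A ψ⟩` (real for the symmetric operators used here). -/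
def quadForm {d : ℕ} (A : Op d) (ψ : Core d) : ℝ :=
  (inner ℂ (toFock d ψ) (toFock d (A ψ))).re

/-- The vector `e^{-βA} ψ`, by the exponential series in the Fock space. The series converges
for every finite combination of eigenvectors of `A`; the Hamiltonians above and the number operator
are diagonal in the occupation states. -/
def expVec {d : ℕ} (β : ℝ) (A : Op d) (ψ : Core d) : Fock d :=
  ∑' j : ℕ, (((-β) ^ j / (j.factorial : ℝ) : ℝ) : ℂ) • toFock d ((A ^ j) ψ)

/-- `Tr e^{-βA}`, a value in `[0, ∞]`, in the orthonormal basis of the occupation states. -/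
def traceExp {d : ℕ} (β : ℝ) (A : Op d) : ENNReal :=
  ∑' n : Occ d, ENNReal.ofReal (inner ℂ (toFock d (ket n)) (expVec β A (ket n))).re

/-- The ground-state energy of `A`: the infimum of `⟨ψ, A ψ⟩` over unit vectors. -/
def groundEnergy {d : ℕ} (A : Op d) : EReal :=
  ⨅ ψ : {ψ : Core d // ‖toFock d ψ‖ = 1}, ((quadForm A ψ.1 : ℝ) : EReal)

/-- The grand-canonical pressure in the cube of side `L`, at temperature `θ ≥ 0` and chemical
potential `μ`, of the model with Hamiltonian `H`. For `θ > 0` it is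
`(1/βV) ln Tr e^{-β(H - μN)}` with `β = 1/θ`, possibly infinite; for `θ = 0` it is the limit
`-(1/V) inf spec (H - μN)` of that quantity as `β → ∞`. -/
def pressure {d : ℕ} (θ L μ : ℝ) (H : Op d) : EReal :=
  if θ = 0 then
    ((1 / L ^ d : ℝ) : EReal) * (-groundEnergy (H - (μ : ℂ) • totalNumber d))
  else
    ((1 / (θ⁻¹ * L ^ d) : ℝ) : EReal) *
      ENNReal.log (traceExp θ⁻¹ (H - (μ : ℂ) • totalNumber d))

/-- The infinite-volume pressure of the perfect Bose gas, for `μ ≤ 0`,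
`p^P = (1/β(2π)^d) ∫ ln (1 - e^{-β(ε_k - μ)})⁻¹ dk` with `β = 1/θ`; it is `0` for `θ = 0`. -/
def perfectPressure (d : ℕ) (hbar m θ μ : ℝ) : ℝ :=
  if θ = 0 then 0
  else 1 / (θ⁻¹ * (2 * Real.pi) ^ d) *
    ∫ k : EuclideanSpace ℝ (Fin d), Real.log ((1 - Real.exp (-θ⁻¹ * (kinetic hbar m k - μ)))⁻¹)

/-- `p^BZ = p^P - inf_{ρ₀ ≥ 0} [(ε₀ - μ) ρ₀ + g₀ ρ₀²/2]`, for `μ ≤ 0`. -/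
def bzPressure (d : ℕ) (hbar m ε₀ g₀ θ μ : ℝ) : ℝ :=
  perfectPressure d hbar m θ μ
    - ⨅ ρ₀ : Set.Ici (0 : ℝ), ((ε₀ - μ) * (ρ₀ : ℝ) + g₀ * (ρ₀ : ℝ) ^ 2 / 2)

/-- The domain of stability: the pairs `(θ, μ)` with `θ ≥ 0` for which the pressure of the toy model
has a thermodynamic limit smaller than `+∞`. -/
def stabilityDomain (d : ℕ) (hbar m ε₀ g₀ lam g : ℝ) : Set (ℝ × ℝ) :=
  {q | 0 ≤ q.1 ∧ ∃ p : EReal, p < ⊤ ∧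
    Filter.Tendsto (fun L : ℝ => pressure q.1 L q.2 (toyHamiltonian d hbar m ε₀ g₀ lam g L))
      Filter.atTop (nhds p)}

/-- On an eigenvector the exponential series converges to `e^{-βE} ψ`. -/
theorem expVec_of_eigenvector {d : ℕ} (β : ℝ) (A : Op d) (ψ : Core d) (E : ℝ)
    (h : A ψ = (E : ℂ) • ψ) :
    expVec β A ψ = ((Real.exp (-β * E) : ℝ) : ℂ) • toFock d ψ := by
  have hp : ∀ j : ℕ, (A ^ j) ψ = ((E : ℂ) ^ j) • ψ := by
    intro j
    induction j with
    | zero => simp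
    | succ j ih => rw [pow_succ', Module.End.mul_apply, ih, map_smul, h, smul_smul, ← pow_succ]
  have hs : HasSum (fun j : ℕ => (-β * E) ^ j / (j.factorial : ℝ)) (Real.exp (-β * E)) := by
    rw [Real.exp_eq_exp_ℝ]
    exact NormedSpace.expSeries_div_hasSum_exp (-β * E)
  have hc : HasSum (fun j : ℕ => (((-β * E) ^ j / (j.factorial : ℝ) : ℝ) : ℂ))
      ((Real.exp (-β * E) : ℝ) : ℂ) := by
    exact_mod_cast Complex.hasSum_ofReal.mpr hs
  have h2 := hc.smul_const (toFock d ψ)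
  rw [expVec, ← h2.tsum_eq]
  congr 1
  funext j
  rw [hp, map_smul, smul_smul]
  congr 1
  push_cast
  ring

theorem number_ket {d : ℕ} (k : Mode d) (n : Occ d) :
    number k (ket n) = ((n k : ℝ) : ℂ) • ket n := by
  have ha : annihilate k (ket n)
      = ((Real.sqrt (n k) : ℝ) : ℂ) • ket (n - Finsupp.single k 1) := by
    simp [annihilate, ket]
  have hc : ∀ n' : Occ d, create k (ket n')
      = ((Real.sqrt (n' k + 1) : ℝ) : ℂ) • ket (n' + Finsupp.single k 1) := by
    intro n'
    simp [create, ket]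
  rw [number, Module.End.mul_apply, ha, map_smul, hc, smul_smul]
  rcases Nat.eq_zero_or_pos (n k) with h0 | h0
  · simp [h0]
  · have e1 : n - Finsupp.single k 1 + Finsupp.single k 1 = n := by
      apply tsub_add_cancel_of_le
      rw [Finsupp.single_le_iff]
      exact h0
    have e2 : (((n - Finsupp.single k 1 : Occ d) k : ℕ) : ℝ) + 1 = n k := by
      have h1 : (n - Finsupp.single k 1 : Occ d) k + 1 = n k := by
        rw [Finsupp.tsub_apply, Finsupp.single_eq_same]
        omega
      exact_mod_cast h1
    rw [e1, e2, ← Complex.ofReal_mul, Real.mul_self_sqrt (by positivity)]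

end BoseToy

end

/-! Every operator here is diagonal in the occupation states, so each pressure is that of a
classical system of occupation numbers (`pressure_eq_gibbsPressure`), and superstability is an
inequality between eigenvalues.

For `H^BZ - αN` the modes are independent and the partition function factorizes. The zero mode obeys
a Laplace principle and contributes `sup_ρ [(α - ε₀)ρ - g₀ρ²/2]`. In the other modes the repulsion
vanishes at each fixed occupation as `V → ∞`, and the logarithms form a Riemann sum for the perfect
gas; `d > 2` makes the `1/|k|²` dominating function integrable near the origin
(`tendsto_pressure_bzHamiltonian`).

Upper bound for the toy model: completing the square gives `λN²/2V - μN ≥ -αN - V(μ-α)²/2λ` for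
every `α`, so `f(α) = p^BZ(α) + (μ-α)²/2λ` bounds the limit for every `α ≤ 0` (`pressure_toy_le`).

Lower bound: for `α < 0` restrict the trace to a thermal cloud of density near `ρ = ∂p^P/∂α`, which
carries all of `p^P` by a Chernoff bound (`eventually_le_thermal_pressure`), put on top of the
optimal density `ρ₀` in the zero mode and an excess density `c ≥ 0` spread evenly over `M` fixed
modes `k ≠ 0`. The kinetic energy of these modes tends to zero and their repulsion costs `g c²/M`,
negligible for large `M`; this is why `g` drops out. With total density `(μ-α)/λ` one has `c =
-f'(α)`, and the bound falls short of `f(α)` only by `α f'(α)` (`eventually_le_pressure_toy`). By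
`exists_small_slope` some `α` has `f'(α) ≤ 0` and an arbitrarily small loss: a stationary point, or
a point close to `0` if `f` decreases throughout. -/

namespace BoseToy

/-! ### Operators that are diagonal in the occupation states -/

/-- `A` is diagonal in the occupation states, with real eigenvalues `E n`. -/
def IsDiagonal {d : ℕ} (A : Op d) (E : Occ d → ℝ) : Prop :=
  ∀ n, A (ket n) = (E n : ℂ) • ket n

/-- The grand-canonical pressure of a classical system with states `i` of energy `W i`. -/
noncomputable def gibbsPressure {ι : Type*} (θ V : ℝ) (W : ι → ℝ) : EReal :=
  if θ = 0 then ((1 / V : ℝ) : EReal) * (-⨅ i, (W i : EReal))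
  else ((1 / (θ⁻¹ * V) : ℝ) : EReal) *
    ENNReal.log (∑' i, ENNReal.ofReal (Real.exp (-θ⁻¹ * W i)))

/-- The number of particles of an occupation. -/
def particles {d : ℕ} (n : Occ d) : ℕ := n.sum fun _ j => j

theorem toFock_ket {d : ℕ} (n : Occ d) : toFock d (ket n) = lp.single 2 n (1 : ℂ) := by
  simp [toFock, ket]

theorem toFock_apply {d : ℕ} (ψ : Core d) (n : Occ d) : (toFock d ψ : Occ d → ℂ) n = ψ n := by
  induction ψ using Finsupp.induction_linear with
  | zero => simp
  | add f g hf hg => rw [map_add, lp.coeFn_add, Pi.add_apply, hf, hg, Finsupp.add_apply]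
  | single m a =>
    rw [toFock, Finsupp.linearCombination_single, lp.coeFn_smul, Pi.smul_apply, lp.single_apply,
      Finsupp.single_apply]
    by_cases h : m = n
    · subst h; simp
    · rw [Pi.single_eq_of_ne (Ne.symm h), if_neg h, smul_zero]

theorem norm_toFock_ket {d : ℕ} (n : Occ d) : ‖toFock d (ket n)‖ = 1 := by
  rw [toFock_ket, lp.norm_single (by norm_num)]
  simp

namespace IsDiagonal

variable {d : ℕ} {A B : Op d} {E F : Occ d → ℝ}

theorem apply (h : IsDiagonal A E) (ψ : Core d) (n : Occ d) : (A ψ) n = (E n : ℂ) * ψ n := by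
  induction ψ using Finsupp.induction_linear with
  | zero => simp
  | add f g hf hg => rw [map_add, Finsupp.add_apply, hf, hg, Finsupp.add_apply, mul_add]
  | single m a =>
    have hs : (Finsupp.single m a : Core d) = a • ket m := by simp [ket]
    rw [hs, map_smul, h m, Finsupp.smul_apply, Finsupp.smul_apply, Finsupp.smul_apply, ket,
      Finsupp.single_apply]
    by_cases hmn : m = n
    · subst hmn; simp [mul_comm]
    · simp [hmn]

theorem add (hA : IsDiagonal A E) (hB : IsDiagonal B F) :
    IsDiagonal (A + B) (fun n => E n + F n) := fun n => by
  rw [LinearMap.add_apply, hA, hB, ← add_smul, Complex.ofReal_add]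

theorem sub (hA : IsDiagonal A E) (hB : IsDiagonal B F) :
    IsDiagonal (A - B) (fun n => E n - F n) := fun n => by
  rw [LinearMap.sub_apply, hA, hB, ← sub_smul, Complex.ofReal_sub]

theorem smul (hA : IsDiagonal A E) (c : ℝ) :
    IsDiagonal ((c : ℂ) • A) (fun n => c * E n) := fun n => by
  rw [LinearMap.smul_apply, hA, smul_smul, Complex.ofReal_mul]

theorem sq (hA : IsDiagonal A E) : IsDiagonal (A ^ 2) (fun n => E n ^ 2) := fun n => by
  rw [pow_two, Module.End.mul_apply, hA, map_smul, hA, smul_smul, ← Complex.ofReal_mul, ← pow_two]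

theorem congr (hA : IsDiagonal A E) (h : ∀ n, E n = F n) : IsDiagonal A F := fun n => by
  rw [hA, h]

theorem quadForm_eq (hA : IsDiagonal A E) (ψ : Core d) :
    quadForm A ψ = ∑ n ∈ ψ.support, ‖ψ n‖ ^ 2 * E n := by
  rw [quadForm, lp.inner_eq_tsum, tsum_eq_sum (s := ψ.support), Complex.re_sum]
  · refine Finset.sum_congr rfl fun n _ => ?_
    rw [toFock_apply, toFock_apply, hA.apply]
    have : inner ℂ (ψ n) ((E n : ℂ) * ψ n) = ((E n * ‖ψ n‖ ^ 2 : ℝ) : ℂ) := by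
      rw [← smul_eq_mul, inner_smul_right, inner_self_eq_norm_sq_to_K]
      push_cast
      rfl
    rw [this, Complex.ofReal_re, mul_comm]
  · intro n hn
    rw [toFock_apply, Finsupp.notMem_support_iff.mp hn, inner_zero_left]

theorem quadForm_ket (hA : IsDiagonal A E) (n : Occ d) : quadForm A (ket n) = E n := by
  rw [hA.quadForm_eq, ket, Finsupp.support_single n, Finset.sum_singleton,
    Finsupp.single_eq_same]
  · simp
  · exact one_ne_zero

theorem norm_sq_toFock (ψ : Core d) : ‖toFock d ψ‖ ^ 2 = ∑ n ∈ ψ.support, ‖ψ n‖ ^ 2 := by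
  have h1 : IsDiagonal (1 : Op d) (fun _ => 1) := fun n => by simp
  have h2 := h1.quadForm_eq ψ
  simp only [mul_one] at h2
  rw [← h2, quadForm, Module.End.one_apply, inner_self_eq_norm_sq_to_K]
  norm_cast

/-- On a unit vector the form is a weighted mean of the eigenvalues in the support, so one of these
eigenvalues does not exceed it. -/
theorem groundEnergy_eq (hA : IsDiagonal A E) : groundEnergy A = ⨅ n, (E n : EReal) := by
  apply le_antisymm
  · refine le_iInf fun n => ?_
    refine (iInf_le _ ⟨ket n, norm_toFock_ket n⟩).trans ?_
    rw [hA.quadForm_ket]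
  · refine le_iInf fun ψ => ?_
    obtain ⟨ψ, hψ⟩ := ψ
    have hsum : ∑ n ∈ ψ.support, ‖ψ n‖ ^ 2 = 1 := by rw [← norm_sq_toFock, hψ, one_pow]
    have hex : ∃ n ∈ ψ.support, E n ≤ quadForm A ψ := by
      by_contra! hcon
      have hne : ψ.support.Nonempty := by
        rw [Finset.nonempty_iff_ne_empty]
        intro h0
        rw [h0] at hsum
        simp at hsum
      have : ∑ n ∈ ψ.support, ‖ψ n‖ ^ 2 * quadForm A ψ < ∑ n ∈ ψ.support, ‖ψ n‖ ^ 2 * E n := by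
        refine Finset.sum_lt_sum_of_nonempty hne fun n hn => ?_
        have : 0 < ‖ψ n‖ := norm_pos_iff.mpr (Finsupp.mem_support_iff.mp hn)
        exact mul_lt_mul_of_pos_left (hcon n hn) (by positivity)
      rw [← Finset.sum_mul, hsum, one_mul, ← hA.quadForm_eq] at this
      exact lt_irrefl _ this
    obtain ⟨n, -, hn⟩ := hex
    exact (iInf_le _ n).trans (EReal.coe_le_coe_iff.mpr hn)

theorem traceExp_eq (hA : IsDiagonal A E) (β : ℝ) :
    traceExp β A = ∑' n, ENNReal.ofReal (Real.exp (-β * E n)) := by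
  refine tsum_congr fun n => ?_
  rw [expVec_of_eigenvector β A _ _ (hA n), inner_smul_right, inner_self_eq_norm_sq_to_K,
    norm_toFock_ket]
  simp [Complex.exp_re]

end IsDiagonal

theorem isDiagonal_number {d : ℕ} (k : Mode d) : IsDiagonal (number k) (fun n => (n k : ℝ)) :=
  number_ket k

theorem annihilate_ket {d : ℕ} (k : Mode d) (n : Occ d) :
    annihilate k (ket n) = ((Real.sqrt (n k) : ℝ) : ℂ) • ket (n - Finsupp.single k 1) := by
  simp [annihilate, ket]

/-- Grouping the product as `a* (a* a) a`, the inner number operator acts on a state from which one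
particle has been removed. For an empty mode the truncated subtraction is harmless because the
prefactor vanishes. -/
theorem isDiagonal_pair {d : ℕ} (k : Mode d) :
    IsDiagonal (create k * create k * annihilate k * annihilate k)
      (fun n => (n k : ℝ) * ((n k : ℝ) - 1)) := fun n => by
  have h1 : (create k * create k * annihilate k * annihilate k) (ket n)
      = create k (number k (annihilate k (ket n))) := by
    simp [number, Module.End.mul_apply]
  have h2 : create k (annihilate k (ket n)) = ((n k : ℝ) : ℂ) • ket n := number_ket k n
  rw [annihilate_ket, map_smul] at h2
  rw [h1, annihilate_ket, map_smul, number_ket, smul_comm, map_smul, map_smul, h2, smul_smul]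
  congr 1
  rw [← Complex.ofReal_mul]
  congr 1
  rw [Finsupp.tsub_apply, Finsupp.single_eq_same]
  rcases Nat.eq_zero_or_pos (n k) with h0 | h0
  · simp [h0]
  · rw [Nat.cast_sub h0]; push_cast; ring

/-- Since empty modes contribute nothing, the sum over all modes reduces on each occupation state to
its finite support. -/
theorem isDiagonal_modeSum {d : ℕ} (s : Set (Mode d)) [DecidablePred (· ∈ s)] {A : Mode d → Op d}
    {w : Mode d → ℕ → ℝ} (hA : ∀ k ∈ s, IsDiagonal (A k) (fun n => w k (n k)))
    (hw : ∀ k, w k 0 = 0) :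
    IsDiagonal (modeSum s A) (fun n => n.sum fun k j => if k ∈ s then w k j else 0) := fun n => by
  have h1 : modeSum s A (ket n) = ∑ᶠ k ∈ s, A k (ket n) := by simp [modeSum, ket]
  have h2 : ∑ᶠ k ∈ s, A k (ket n)
      = ∑ᶠ k, if k ∈ s then ((w k (n k) : ℝ) : ℂ) • ket n else 0 := by
    refine finsum_congr fun k => ?_
    by_cases hk : k ∈ s
    · simp [hk, hA k hk n]
    · simp [hk]
  rw [h1, h2, finsum_eq_sum_of_support_subset (s := n.support)]
  · simp only [Finsupp.sum]
    rw [Complex.ofReal_sum, Finset.sum_smul]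
    refine Finset.sum_congr rfl fun k _ => ?_
    by_cases hk : k ∈ s <;> simp [hk]
  · intro k hk
    rw [Function.mem_support] at hk
    rw [Finset.mem_coe, Finsupp.mem_support_iff]
    intro h0
    apply hk
    simp [h0, hw]

theorem isDiagonal_totalNumber (d : ℕ) :
    IsDiagonal (totalNumber d) (fun n => (particles n : ℝ)) := by
  classical
  refine (isDiagonal_modeSum Set.univ (w := fun _ j => (j : ℝ))
    (fun k _ => isDiagonal_number k) (fun k => by simp)).congr fun n => ?_
  simp [particles, Finsupp.sum]

/-- The contribution of `j` particles in the mode `k` to the energy of the toy model, without the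
mean-field term. -/
noncomputable def toyWeight {d : ℕ} (hbar m ε₀ g₀ g L : ℝ) (k : Mode d) (j : ℕ) : ℝ :=
  if k = 0 then ε₀ * j + g₀ / (2 * L ^ d) * (j : ℝ) ^ 2
  else kinetic hbar m (momentum L k) * j + g / (2 * L ^ d) * (j : ℝ) ^ 2

/-- The contribution of `j` particles in the mode `k` to the energy of `H^BZ`. -/
noncomputable def bzWeight {d : ℕ} (hbar m ε₀ g₀ : ℝ) (gk : Mode d → ℝ → ℝ) (L : ℝ) (k : Mode d)
    (j : ℕ) : ℝ :=
  if k = 0 then ε₀ * j + g₀ / (2 * L ^ d) * ((j : ℝ) * ((j : ℝ) - 1))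
  else kinetic hbar m (momentum L k) * j + 1 / L ^ d * (gk k (L ^ d) * ((j : ℝ) * ((j : ℝ) - 1)))

theorem sum_ite_eq_zero {d : ℕ} (n : Occ d) (w : ℕ → ℝ) (hw : w 0 = 0) :
    n.sum (fun k j => if k = 0 then w j else 0) = w (n 0) := by
  classical
  rw [Finsupp.sum, Finset.sum_ite_eq']
  split_ifs with h
  · rfl
  · rw [Finsupp.notMem_support_iff.mp h, hw]

theorem isDiagonal_toyHamiltonian (d : ℕ) (hbar m ε₀ g₀ lam g L : ℝ) :
    IsDiagonal (toyHamiltonian d hbar m ε₀ g₀ lam g L)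
      (fun n => n.sum (toyWeight hbar m ε₀ g₀ g L)
        + lam / (2 * L ^ d) * (particles n : ℝ) ^ 2) := by
  classical
  have h1 := isDiagonal_modeSum (d := d) {0}ᶜ
    (A := fun k => ((kinetic hbar m (momentum L k) : ℝ) : ℂ) • number k)
    (w := fun k j => kinetic hbar m (momentum L k) * j)
    (fun k _ => (isDiagonal_number k).smul _) (fun k => by simp)
  have h2 := (isDiagonal_number (d := d) 0).smul ε₀
  have h3 := (isDiagonal_number (d := d) 0).sq.smul (g₀ / (2 * L ^ d))
  have h4 := (isDiagonal_totalNumber d).sq.smul (lam / (2 * L ^ d))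
  have h5 := (isDiagonal_modeSum (d := d) {0}ᶜ (A := fun k => number k ^ 2)
    (w := fun k j => (j : ℝ) ^ 2)
    (fun k _ => (isDiagonal_number k).sq) (fun k => by simp)).smul (g / (2 * L ^ d))
  refine ((((h1.add h2).add h3).add h4).add h5).congr fun n => ?_
  have e2 := sum_ite_eq_zero n (fun j => ε₀ * j + g₀ / (2 * L ^ d) * (j : ℝ) ^ 2) (by simp)
  have e3 : n.sum (toyWeight hbar m ε₀ g₀ g L)
      = n.sum (fun k j => if k ∈ ({0}ᶜ : Set (Mode d)) then kinetic hbar m (momentum L k) * j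
          else 0)
        + n.sum (fun k j => if k = 0 then ε₀ * j + g₀ / (2 * L ^ d) * (j : ℝ) ^ 2 else 0)
        + g / (2 * L ^ d) * n.sum
          (fun k j => if k ∈ ({0}ᶜ : Set (Mode d)) then (j : ℝ) ^ 2 else 0) := by
    simp only [Finsupp.sum]
    rw [Finset.mul_sum, ← Finset.sum_add_distrib, ← Finset.sum_add_distrib]
    refine Finset.sum_congr rfl fun k _ => ?_
    by_cases hk : k = 0 <;> simp [toyWeight, hk]
  rw [e3, e2]
  ring

theorem isDiagonal_bzHamiltonian (d : ℕ) (hbar m ε₀ g₀ : ℝ) (gk : Mode d → ℝ → ℝ) (L : ℝ) :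
    IsDiagonal (bzHamiltonian d hbar m ε₀ g₀ gk L)
      (fun n => n.sum (bzWeight hbar m ε₀ g₀ gk L)) := by
  classical
  have h1 := isDiagonal_modeSum (d := d) {0}ᶜ
    (A := fun k => ((kinetic hbar m (momentum L k) : ℝ) : ℂ) • number k)
    (w := fun k j => kinetic hbar m (momentum L k) * j)
    (fun k _ => (isDiagonal_number k).smul _) (fun k => by simp)
  have h2 := (isDiagonal_number (d := d) 0).smul ε₀
  have h3 := (isDiagonal_pair (d := d) 0).smul (g₀ / (2 * L ^ d))
  have h5 := (isDiagonal_modeSum (d := d) {0}ᶜ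
    (A := fun k => ((gk k (L ^ d) : ℝ) : ℂ) •
      (create k * create k * annihilate k * annihilate k))
    (w := fun k j => gk k (L ^ d) * ((j : ℝ) * ((j : ℝ) - 1)))
    (fun k _ => (isDiagonal_pair k).smul _) (fun k => by simp)).smul (1 / L ^ d)
  refine (((h1.add h2).add h3).add h5).congr fun n => ?_
  have e2 := sum_ite_eq_zero n
    (fun j => ε₀ * j + g₀ / (2 * L ^ d) * ((j : ℝ) * ((j : ℝ) - 1))) (by simp)
  have e3 : n.sum (bzWeight hbar m ε₀ g₀ gk L)
      = n.sum (fun k j => if k ∈ ({0}ᶜ : Set (Mode d)) then kinetic hbar m (momentum L k) * j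
          else 0)
        + n.sum (fun k j => if k = 0
          then ε₀ * j + g₀ / (2 * L ^ d) * ((j : ℝ) * ((j : ℝ) - 1)) else 0)
        + 1 / L ^ d * n.sum (fun k j => if k ∈ ({0}ᶜ : Set (Mode d))
          then gk k (L ^ d) * ((j : ℝ) * ((j : ℝ) - 1)) else 0) := by
    simp only [Finsupp.sum]
    rw [Finset.mul_sum, ← Finset.sum_add_distrib, ← Finset.sum_add_distrib]
    refine Finset.sum_congr rfl fun k _ => ?_
    by_cases hk : k = 0 <;> simp [bzWeight, hk]
  rw [e3, e2]
  ring

theorem pressure_eq_gibbsPressure {d : ℕ} {H : Op d} {E : Occ d → ℝ} (hH : IsDiagonal H E)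
    (θ L μ : ℝ) :
    pressure θ L μ H = gibbsPressure θ (L ^ d) (fun n => E n - μ * particles n) := by
  have h := hH.sub ((isDiagonal_totalNumber d).smul μ)
  rw [pressure, gibbsPressure, h.groundEnergy_eq, h.traceExp_eq]

theorem kinetic_nonneg {d : ℕ} (hbar : ℝ) {m : ℝ} (hm : 0 < m) (k : EuclideanSpace ℝ (Fin d)) :
    0 ≤ kinetic hbar m k := by
  unfold kinetic; positivity

/-- The mean-field term matches exactly. What remains is that each mode has energy at least `ε₀` per
particle: the repulsions are nonnegative and the kinetic energies exceed `ε₀ < 0`. -/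
theorem toyHamiltonian_superstable (d : ℕ) (hbar : ℝ) {m ε₀ g₀ g L : ℝ} (lam : ℝ) (hm : 0 < m)
    (hε₀ : ε₀ < 0) (hg₀ : 0 < g₀) (hg : 0 < g) (hL : 0 < L) (ψ : Core d) :
    ε₀ * quadForm (totalNumber d) ψ + (lam / 2) / L ^ d * quadForm (totalNumber d ^ 2) ψ
      ≤ quadForm (toyHamiltonian d hbar m ε₀ g₀ lam g L) ψ := by
  rw [(isDiagonal_totalNumber d).quadForm_eq, (isDiagonal_totalNumber d).sq.quadForm_eq,
    (isDiagonal_toyHamiltonian d hbar m ε₀ g₀ lam g L).quadForm_eq, Finset.mul_sum, Finset.mul_sum,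
    ← Finset.sum_add_distrib]
  refine Finset.sum_le_sum fun n _ => ?_
  have h1 : ε₀ * (particles n : ℝ) ≤ n.sum (toyWeight hbar m ε₀ g₀ g L) := by
    rw [particles, Finsupp.sum, Finsupp.sum, Nat.cast_sum, Finset.mul_sum]
    refine Finset.sum_le_sum fun k _ => ?_
    have hn : (0 : ℝ) ≤ n k := Nat.cast_nonneg _
    have hk := kinetic_nonneg hbar hm (momentum L k)
    unfold toyWeight
    split_ifs
    · have : 0 ≤ g₀ / (2 * L ^ d) * (n k : ℝ) ^ 2 := by positivity
      linarith
    · have : 0 ≤ g / (2 * L ^ d) * (n k : ℝ) ^ 2 := by positivity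
      nlinarith
  have h2 : ‖ψ n‖ ^ 2 * (ε₀ * (particles n : ℝ))
      ≤ ‖ψ n‖ ^ 2 * n.sum (toyWeight hbar m ε₀ g₀ g L) :=
    mul_le_mul_of_nonneg_left h1 (by positivity)
  have e : lam / 2 / L ^ d = lam / (2 * L ^ d) := by rw [div_div]
  rw [e]
  linarith

/-! ### Partition functions of independent modes -/

open scoped ENNReal in
/-- Over occupations supported in a finite set of modes the partition function factorizes. -/
theorem tsum_supported_prod {ι : Type*} [DecidableEq ι] (a : ι → ℕ → ℝ≥0∞) (h0 : ∀ k, a k 0 = 1)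
    (S : Finset ι) :
    ∑' n : {n : ι →₀ ℕ // n.support ⊆ S}, n.1.prod a = ∏ k ∈ S, ∑' j, a k j := by
  induction S using Finset.induction_on with
  | empty =>
    have : ∀ n : {n : ι →₀ ℕ // n.support ⊆ ∅}, n = ⟨0, by simp⟩ := by
      rintro ⟨n, hn⟩
      have : n = 0 := Finsupp.support_eq_empty.mp (Finset.subset_empty.mp hn)
      subst this; rfl
    rw [tsum_eq_single ⟨0, by simp⟩ (fun n hn => absurd (this n) hn)]
    simp
  | insert k S hk ih =>
    -- Splitting off the occupation of the new mode `k` turns the sum into a double sum.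
    let e : ℕ × {n : ι →₀ ℕ // n.support ⊆ S} ≃ {n : ι →₀ ℕ // n.support ⊆ insert k S} :=
      { toFun := fun p => ⟨Finsupp.single k p.1 + p.2.1, by
          refine Finsupp.support_add.trans (Finset.union_subset ?_ ?_)
          · exact Finsupp.support_single_subset.trans (by simp)
          · exact p.2.2.trans (Finset.subset_insert _ _)⟩
        invFun := fun n => ⟨n.1 k, n.1.erase k, by
          rw [Finsupp.support_erase]
          intro x hx
          rw [Finset.mem_erase] at hx
          exact (Finset.mem_insert.mp (n.2 hx.2)).resolve_left hx.1⟩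
        left_inv := by
          rintro ⟨j, n, hn⟩
          have hnk : n k = 0 := Finsupp.notMem_support_iff.mp fun h => hk (hn h)
          have h1 : (Finsupp.single k j + n) k = j := by simp [hnk]
          have h2 : (Finsupp.single k j + n).erase k = n := by
            rw [Finsupp.erase_add, Finsupp.erase_single, zero_add, Finsupp.erase_of_notMem_support]
            exact fun h => hk (hn h)
          simp [h2, hnk]
        right_inv := by
          rintro ⟨n, hn⟩
          simp [Finsupp.single_add_erase] }
    rw [Finset.prod_insert hk, ← ih, ← e.tsum_eq, ENNReal.tsum_prod', ← ENNReal.tsum_mul_right]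
    refine tsum_congr fun j => ?_
    rw [← ENNReal.tsum_mul_left]
    refine tsum_congr fun n => ?_
    change (Finsupp.single k j + n.1).prod a = _
    rw [Finsupp.prod_add_index_of_disjoint, Finsupp.prod_single_index (h0 k)]
    refine Finset.disjoint_of_subset_left Finsupp.support_single_subset ?_
    rw [Finset.disjoint_singleton_left]
    exact fun h => hk (n.2 h)

open scoped ENNReal in
-- Any finite family of occupations lives on the union of its supports, a finite set of modes, where
-- the factorization is available. Working in `ℝ≥0∞` avoids all convergence questions.
theorem tsum_prod_eq_iSup {ι : Type*} (a : ι → ℕ → ℝ≥0∞) (h0 : ∀ k, a k 0 = 1) :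
    ∑' n : ι →₀ ℕ, n.prod a = ⨆ S : Finset ι, ∏ k ∈ S, ∑' j, a k j := by
  classical
  apply le_antisymm
  · rw [ENNReal.tsum_eq_iSup_sum]
    refine iSup_le fun T => ?_
    refine le_trans ?_ (le_iSup _ (T.sup Finsupp.support))
    rw [← tsum_supported_prod a h0]
    have h1 : ∀ n ∈ T, n.support ⊆ T.sup Finsupp.support := fun n hn =>
      Finset.le_sup (f := Finsupp.support) hn
    rw [← Finset.sum_attach]
    let f : {n // n ∈ T} ↪ {n : ι →₀ ℕ // n.support ⊆ T.sup Finsupp.support} :=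
      ⟨fun n => ⟨n.1, h1 n.1 n.2⟩, fun x y h => Subtype.ext (congrArg (fun z => z.1) h)⟩
    have h2 := ENNReal.sum_le_tsum (f := fun n : {n : ι →₀ ℕ // n.support ⊆ T.sup Finsupp.support} =>
      n.1.prod a) (T.attach.map f)
    rwa [Finset.sum_map] at h2
  · refine iSup_le fun S => ?_
    rw [← tsum_supported_prod a h0]
    exact ENNReal.tsum_comp_le_tsum_of_injective Subtype.val_injective _

/-- The grand partition function of independent modes: the sum over all occupations is the product
of the sums over the single modes. -/
theorem tsum_exp_neg_sum_eq {ι : Type*} (w : ι → ℕ → ℝ) (h0 : ∀ k, w k 0 = 0)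
    (hs : ∀ k, Summable fun j => Real.exp (-w k j))
    (hl : Summable fun k => Real.log (∑' j, Real.exp (-w k j))) :
    ∑' n : ι →₀ ℕ, ENNReal.ofReal (Real.exp (-n.sum w))
      = ENNReal.ofReal (Real.exp (∑' k, Real.log (∑' j, Real.exp (-w k j)))) := by
  have hone : ∀ k, 1 ≤ ∑' j, Real.exp (-w k j) := fun k => by
    have := (hs k).le_tsum 0 fun _ _ => (Real.exp_pos _).le
    simpa [h0 k] using this
  have e1 : ∀ n : ι →₀ ℕ, ENNReal.ofReal (Real.exp (-n.sum w))
      = n.prod fun k j => ENNReal.ofReal (Real.exp (-w k j)) := fun n => by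
    rw [Finsupp.sum, Finsupp.prod, ← Finset.sum_neg_distrib, Real.exp_sum,
      ENNReal.ofReal_prod_of_nonneg fun _ _ => (Real.exp_pos _).le]
  simp_rw [e1]
  rw [tsum_prod_eq_iSup _ fun k => by simp [h0 k]]
  have e2 : ∀ S : Finset ι, ∏ k ∈ S, ∑' j, ENNReal.ofReal (Real.exp (-w k j))
      = ENNReal.ofReal (Real.exp (∑ k ∈ S, Real.log (∑' j, Real.exp (-w k j)))) := fun S => by
    rw [Real.exp_sum, ENNReal.ofReal_prod_of_nonneg fun _ _ => (Real.exp_pos _).le]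
    refine Finset.prod_congr rfl fun k _ => ?_
    rw [Real.exp_log (zero_lt_one.trans_le (hone k)),
      ENNReal.ofReal_tsum_of_nonneg (fun _ => (Real.exp_pos _).le) (hs k)]
  simp_rw [e2]
  have hlog : ∀ k, 0 ≤ Real.log (∑' j, Real.exp (-w k j)) := fun k => Real.log_nonneg (hone k)
  apply le_antisymm
  · refine iSup_le fun S => ENNReal.ofReal_le_ofReal (Real.exp_le_exp.mpr ?_)
    exact hl.sum_le_tsum S fun k _ => hlog k
  · have ht : Filter.Tendsto (fun S : Finset ι =>
        ENNReal.ofReal (Real.exp (∑ k ∈ S, Real.log (∑' j, Real.exp (-w k j)))))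
        Filter.atTop (nhds (ENNReal.ofReal
          (Real.exp (∑' k, Real.log (∑' j, Real.exp (-w k j)))))) :=
      ENNReal.tendsto_ofReal ((Real.continuous_exp.tendsto _).comp hl.hasSum)
    exact le_of_tendsto' ht fun S => le_iSup (fun S : Finset ι =>
      ENNReal.ofReal (Real.exp (∑ k ∈ S, Real.log (∑' j, Real.exp (-w k j))))) S

open MeasureTheory Filter Topology

/-! ### Riemann sums over the dual lattice -/

/-- The label of the momentum cell, of side `2π/L`, that contains `q`. -/
noncomputable def cell {d : ℕ} (L : ℝ) (q : EuclideanSpace ℝ (Fin d)) : Mode d :=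
  fun i => ⌊q i * L / (2 * Real.pi)⌋

theorem measurable_cell {d : ℕ} (L : ℝ) : Measurable (cell (d := d) L) := by
  refine measurable_pi_iff.mpr fun i => Int.measurable_floor.comp ?_
  fun_prop

theorem cell_bounds {d : ℕ} {L : ℝ} (hL : 0 < L) (q : EuclideanSpace ℝ (Fin d)) (i : Fin d) :
    momentum L (cell L q) i ≤ q i ∧ q i < momentum L (cell L q) i + 2 * Real.pi / L := by
  have h1 := Int.floor_le (q i * L / (2 * Real.pi))
  have h2 := Int.lt_floor_add_one (q i * L / (2 * Real.pi))
  have hpi := Real.pi_pos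
  rw [le_div_iff₀ (by positivity)] at h1
  rw [div_lt_iff₀ (by positivity)] at h2
  constructor
  · change 2 * Real.pi * (cell L q i : ℝ) / L ≤ q i
    rw [div_le_iff₀ hL]
    change 2 * Real.pi * (⌊q i * L / (2 * Real.pi)⌋ : ℝ) ≤ q i * L
    linarith
  · change q i < 2 * Real.pi * (cell L q i : ℝ) / L + 2 * Real.pi / L
    rw [← add_div, lt_div_iff₀ hL]
    change q i * L < 2 * Real.pi * (⌊q i * L / (2 * Real.pi)⌋ : ℝ) + 2 * Real.pi
    linarith

theorem volume_cell_preimage {d : ℕ} {L : ℝ} (hL : 0 < L) (k : Mode d) :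
    volume (cell L ⁻¹' {k}) = ENNReal.ofReal ((2 * Real.pi / L) ^ d) := by
  have hpi := Real.pi_pos
  have hpre : cell L ⁻¹' {k} = (MeasurableEquiv.toLp 2 (Fin d → ℝ)).symm ⁻¹'
      (Set.univ.pi fun i => Set.Ico ((k i : ℝ) * (2 * Real.pi / L))
        (((k i : ℝ) + 1) * (2 * Real.pi / L))) := by
    ext q
    rw [Set.mem_preimage, Set.mem_singleton_iff, funext_iff, Set.mem_preimage, Set.mem_univ_pi]
    refine forall_congr' fun i => ?_
    change ⌊q i * L / (2 * Real.pi)⌋ = k i ↔ _ ≤ q i ∧ q i < _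
    rw [Int.floor_eq_iff, le_div_iff₀ (by positivity), div_lt_iff₀ (by positivity),
      mul_div_assoc', div_le_iff₀ hL, mul_div_assoc', lt_div_iff₀ hL]
  rw [hpre, (EuclideanSpace.volume_preserving_symm_measurableEquiv_toLp (Fin d)).measure_preimage_equiv,
    Real.volume_pi_Ico]
  have : ∀ i : Fin d, ((k i : ℝ) + 1) * (2 * Real.pi / L) - (k i : ℝ) * (2 * Real.pi / L)
      = 2 * Real.pi / L := fun i => by ring
  simp only [this, Finset.prod_const, Finset.card_univ, Fintype.card_fin]
  rw [ENNReal.ofReal_pow (by positivity)]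

/-- All cells have the same volume, so lattice sums are exactly integrals of step functions. Their
convergence thus becomes a matter of dominated convergence. -/
theorem map_cell_volume {d : ℕ} {L : ℝ} (hL : 0 < L) :
    (volume : Measure (EuclideanSpace ℝ (Fin d))).map (cell L)
      = ENNReal.ofReal ((2 * Real.pi / L) ^ d) • Measure.count := by
  refine Measure.ext_of_singleton fun k => ?_
  rw [Measure.map_apply (measurable_cell L) (measurableSet_singleton k), volume_cell_preimage hL]
  simp

theorem summable_of_integrable_cell {d : ℕ} {L : ℝ} (hL : 0 < L) {a : Mode d → ℝ}
    (ha : Integrable fun q : EuclideanSpace ℝ (Fin d) => a (cell L q)) :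
    Summable a ∧ ∫ q : EuclideanSpace ℝ (Fin d), a (cell L q)
      = (2 * Real.pi / L) ^ d * ∑' k, a k := by
  have hpi := Real.pi_pos
  have hm : AEStronglyMeasurable a
      ((volume : Measure (EuclideanSpace ℝ (Fin d))).map (cell L)) :=
    (measurable_of_countable a).aestronglyMeasurable
  have h1 : Integrable a ((volume : Measure (EuclideanSpace ℝ (Fin d))).map (cell L)) :=
    (integrable_map_measure hm (measurable_cell L).aemeasurable).mpr ha
  have hint := integral_map (measurable_cell (d := d) L).aemeasurable hm
  rw [map_cell_volume hL] at h1 hint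
  have h2 : Integrable a Measure.count := by
    rwa [integrable_smul_measure (by simpa using by positivity) ENNReal.ofReal_ne_top] at h1
  refine ⟨(integrable_count_iff.mp h2).of_norm, ?_⟩
  rw [← hint, integral_smul_measure, integral_countable h2,
    ENNReal.toReal_ofReal (by positivity)]
  simp [measureReal_def]

theorem norm_sub_momentum_cell {d : ℕ} {L : ℝ} (hL : 0 < L) (q : EuclideanSpace ℝ (Fin d)) :
    ‖q - momentum L (cell L q)‖ ^ 2 ≤ d * (2 * Real.pi / L) ^ 2 := by
  rw [EuclideanSpace.real_norm_sq_eq]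
  refine (Finset.sum_le_card_nsmul _ _ ((2 * Real.pi / L) ^ 2) fun i _ => ?_).trans (by simp)
  obtain ⟨h1, h2⟩ := cell_bounds hL q i
  have h3 : (q - momentum L (cell L q)) i = q i - momentum L (cell L q) i := rfl
  rw [h3]
  exact pow_le_pow_left₀ (by linarith) (by linarith) 2

theorem tendsto_momentum_cell {d : ℕ} (q : EuclideanSpace ℝ (Fin d)) :
    Tendsto (fun L : ℝ => momentum L (cell L q)) atTop (𝓝 q) := by
  have h0 : Tendsto (fun L : ℝ => √(d * (2 * Real.pi / L) ^ 2)) atTop (𝓝 0) := by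
    have h1 : Tendsto (fun L : ℝ => 2 * Real.pi / L) atTop (𝓝 0) :=
      tendsto_const_nhds.div_atTop tendsto_id
    have h2 := ((h1.pow 2).const_mul (d : ℝ)).sqrt
    simpa using h2
  rw [tendsto_iff_norm_sub_tendsto_zero]
  refine squeeze_zero' (Eventually.of_forall fun L => norm_nonneg _) ?_ h0
  filter_upwards [eventually_gt_atTop 0] with L hL
  rw [norm_sub_rev]
  exact Real.le_sqrt_of_sq_le (norm_sub_momentum_cell hL q)

theorem two_pi_div_sq_le_norm_sq {d : ℕ} {L : ℝ} {k : Mode d} (hk : k ≠ 0) :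
    (2 * Real.pi / L) ^ 2 ≤ ‖momentum L k‖ ^ 2 := by
  obtain ⟨i, hi⟩ := Function.ne_iff.mp hk
  rw [EuclideanSpace.real_norm_sq_eq]
  refine le_trans ?_ (Finset.single_le_sum (f := fun i => momentum L k i ^ 2)
    (fun _ _ => sq_nonneg _) (Finset.mem_univ i))
  change _ ≤ (2 * Real.pi * (k i : ℝ) / L) ^ 2
  have h1 : (1 : ℝ) ≤ (k i : ℝ) ^ 2 := by
    have : (1 : ℤ) ≤ k i ^ 2 := Order.one_le_iff_pos.mpr (by have : k i ≠ 0 := hi; positivity)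
    exact_mod_cast this
  have h2 : (2 * Real.pi * (k i : ℝ) / L) ^ 2 = (2 * Real.pi / L) ^ 2 * (k i : ℝ) ^ 2 := by ring
  rw [h2]
  exact le_mul_of_one_le_right (sq_nonneg _) h1

/-- The point `q` is within `√d · 2π/L` of its cell's corner, and a nonzero corner has norm at least
`2π/L`; then `(a + b)² ≤ 2a² + 2b²`. The constant does not depend on `L`, which yields a dominating
function uniform in the volume. -/
theorem norm_sq_le_of_cell_ne_zero {d : ℕ} {L : ℝ} (hL : 0 < L) {q : EuclideanSpace ℝ (Fin d)}
    (hq : cell L q ≠ 0) : ‖q‖ ^ 2 ≤ 2 * (d + 1) * ‖momentum L (cell L q)‖ ^ 2 := by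
  have h1 := norm_sub_momentum_cell hL q
  have h2 := two_pi_div_sq_le_norm_sq (L := L) hq
  have h3 : ‖q‖ ≤ ‖q - momentum L (cell L q)‖ + ‖momentum L (cell L q)‖ := by
    simpa using norm_add_le (q - momentum L (cell L q)) (momentum L (cell L q))
  have h4 : (d : ℝ) * (2 * Real.pi / L) ^ 2 ≤ d * ‖momentum L (cell L q)‖ ^ 2 := by gcongr
  nlinarith [norm_nonneg q, sq_nonneg (‖q - momentum L (cell L q)‖ - ‖momentum L (cell L q)‖),
    pow_le_pow_left₀ (norm_nonneg q) h3 2]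

/-- Dominated convergence for sums over the dual lattice. -/
theorem tendsto_lattice_sum {d : ℕ} {a : ℝ → Mode d → ℝ} {f G : EuclideanSpace ℝ (Fin d) → ℝ}
    (hG : Integrable G) (hbound : ∀ᶠ L in atTop, ∀ q, |a L (cell L q)| ≤ G q)
    (hlim : ∀ᵐ q, Tendsto (fun L => a L (cell L q)) atTop (𝓝 (f q))) :
    (∀ᶠ L in atTop, Summable (a L)) ∧
      Tendsto (fun L => (1 / L ^ d) * ∑' k, a L k) atTop
        (𝓝 (1 / (2 * Real.pi) ^ d * ∫ q, f q)) := by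
  have hpi := Real.pi_pos
  have hmeas : ∀ L, AEStronglyMeasurable (fun q : EuclideanSpace ℝ (Fin d) => a L (cell L q)) :=
    fun L => ((measurable_of_countable (a L)).comp (measurable_cell L)).aestronglyMeasurable
  have hkey : ∀ᶠ L in atTop, 0 < L ∧
      Integrable fun q : EuclideanSpace ℝ (Fin d) => a L (cell L q) := by
    filter_upwards [hbound, eventually_gt_atTop 0] with L hb hL
    exact ⟨hL, hG.mono' (hmeas L) (Eventually.of_forall fun q => hb q)⟩
  refine ⟨hkey.mono fun L h => (summable_of_integrable_cell h.1 h.2).1, ?_⟩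
  have h1 := tendsto_integral_filter_of_dominated_convergence G
    (Eventually.of_forall hmeas) (hbound.mono fun L hb => Eventually.of_forall fun q => hb q)
    hG hlim
  refine (h1.const_mul (1 / (2 * Real.pi) ^ d)).congr' ?_
  filter_upwards [hkey] with L hL
  rw [(summable_of_integrable_cell hL.1 hL.2).2, div_pow]
  have := hL.1
  field_simp

/-! ### The perfect Bose gas -/

/-- `e^{-x/2}/x` dominates the single-mode pressure `-ln (1 - e^{-x})`. -/
theorem log_inv_one_sub_exp_le {x : ℝ} (hx : 0 < x) :
    Real.log ((1 - Real.exp (-x))⁻¹) ≤ Real.exp (-(x / 2)) / x := by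
  have h0 : Real.exp (-x) < 1 := Real.exp_zero ▸ Real.exp_lt_exp.mpr (by linarith)
  have hpos : 0 < 1 - Real.exp (-x) := by linarith
  have h1 := Real.log_le_sub_one_of_pos (inv_pos.mpr hpos)
  refine h1.trans ?_
  -- After `ln t ≤ t - 1` the quantity to bound is `e^{-x/2} / (2 sinh (x/2))`.
  have h2 : x ≤ Real.exp (x / 2) - Real.exp (-(x / 2)) := by
    have := Real.self_le_sinh_iff.mpr (by linarith : 0 ≤ x / 2)
    rw [Real.sinh_eq] at this
    linarith
  have e1 : Real.exp (-x) = Real.exp (-(x / 2)) * Real.exp (-(x / 2)) := by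
    rw [← Real.exp_add]; ring_nf
  have e2 : Real.exp (x / 2) * Real.exp (-(x / 2)) = 1 := by
    rw [← Real.exp_add]; simp
  rw [le_div_iff₀ hx]
  have e3 : (1 - Real.exp (-x))⁻¹ - 1 = Real.exp (-x) / (1 - Real.exp (-x)) := by
    field_simp; ring
  rw [e3, div_mul_eq_mul_div, div_le_iff₀ hpos]
  have hp := Real.exp_pos (-(x / 2))
  set u := Real.exp (-(x / 2))
  have h3 : u * (x * u) ≤ u * (1 - u * u) := by
    refine mul_le_mul_of_nonneg_left ?_ hp.le
    nlinarith
  rw [e1]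
  linarith

/-- In polar coordinates the integrand is `y^(d-3) e^{-b y²}` up to a constant. This is where `d >
2` is essential. -/
theorem integrable_exp_neg_div_norm_sq {d : ℕ} (hd : 2 < d) {b : ℝ} (hb : 0 < b) (C : ℝ) :
    Integrable fun q : EuclideanSpace ℝ (Fin d) =>
      Real.exp (-(b * ‖q‖ ^ 2)) / (C * ‖q‖ ^ 2) := by
  have : Nonempty (Fin d) := ⟨⟨0, by omega⟩⟩
  rw [integrable_fun_norm_addHaar volume
    (f := fun y : ℝ => Real.exp (-(b * y ^ 2)) / (C * y ^ 2)), finrank_euclideanSpace,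
    Fintype.card_fin]
  have h1 := (integrableOn_rpow_mul_exp_neg_mul_sq hb (s := (d : ℝ) - 3) (by
    have : (3 : ℝ) ≤ d := by exact_mod_cast hd
    linarith)).const_mul (1 / C)
  refine (integrableOn_congr_fun (fun y hy => ?_) measurableSet_Ioi).mp h1
  have hy' : (0 : ℝ) < y := hy
  have e1 : y ^ ((d : ℝ) - 3) * y ^ 2 = y ^ (d - 1) := by
    rw [← Real.rpow_natCast y 2, ← Real.rpow_add hy', ← Real.rpow_natCast y (d - 1),
      Nat.cast_sub (by omega)]
    congr 1; push_cast; ring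
  simp only [smul_eq_mul]
  rw [← e1, neg_mul]
  rcases eq_or_ne C 0 with rfl | hC
  · simp
  · field_simp

/-! ### Single modes -/

theorem exp_neg_nat_mul (y : ℝ) (j : ℕ) : Real.exp (-(y * j)) = Real.exp (-y) ^ j := by
  rw [← Real.exp_nat_mul]; ring_nf

theorem exp_neg_lt_one {y : ℝ} (hy : 0 < y) : Real.exp (-y) < 1 :=
  Real.exp_zero ▸ Real.exp_lt_exp.mpr (by linarith)

theorem summable_exp_neg_nat_mul {y : ℝ} (hy : 0 < y) :
    Summable fun j : ℕ => Real.exp (-(y * j)) := by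
  simp_rw [exp_neg_nat_mul]
  exact summable_geometric_of_lt_one (Real.exp_pos _).le (exp_neg_lt_one hy)

theorem tsum_exp_neg_nat_mul {y : ℝ} (hy : 0 < y) :
    ∑' j : ℕ, Real.exp (-(y * j)) = (1 - Real.exp (-y))⁻¹ := by
  simp_rw [exp_neg_nat_mul]
  exact tsum_geometric_of_lt_one (Real.exp_pos _).le (exp_neg_lt_one hy)

theorem summable_exp_neg {y : ℝ} (hy : 0 < y) {w : ℕ → ℝ} (hw : ∀ j : ℕ, y * j ≤ w j) :
    Summable fun j => Real.exp (-w j) :=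
  (summable_exp_neg_nat_mul hy).of_nonneg_of_le (fun _ => (Real.exp_pos _).le)
    fun j => Real.exp_le_exp.mpr (neg_le_neg (hw j))

theorem one_le_tsum_exp_neg {w : ℕ → ℝ} (h0 : w 0 = 0) (hs : Summable fun j => Real.exp (-w j)) :
    1 ≤ ∑' j, Real.exp (-w j) := by
  have := hs.le_tsum 0 fun _ _ => (Real.exp_pos _).le
  simpa [h0] using this

theorem log_tsum_exp_neg_le {y : ℝ} (hy : 0 < y) {w : ℕ → ℝ} (h0 : w 0 = 0)
    (hw : ∀ j : ℕ, y * j ≤ w j) :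
    Real.log (∑' j, Real.exp (-w j)) ≤ Real.log ((1 - Real.exp (-y))⁻¹) := by
  have hs := summable_exp_neg hy hw
  refine Real.log_le_log (zero_lt_one.trans_le (one_le_tsum_exp_neg h0 hs)) ?_
  rw [← tsum_exp_neg_nat_mul hy]
  exact hs.tsum_le_tsum (fun j => Real.exp_le_exp.mpr (neg_le_neg (hw j)))
    (summable_exp_neg_nat_mul hy)

/-- The perturbation `η` need only vanish for each fixed occupation `j`, because the lower bound on
`w` alone supplies a geometric dominating series of rate `y₀/2`. -/
theorem tendsto_log_tsum_exp_neg {ι : Type*} {l : Filter ι} {y : ι → ℝ} {y₀ : ℝ} (hy₀ : 0 < y₀)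
    (hy : Tendsto y l (𝓝 y₀)) {w : ι → ℕ → ℝ} {η : ι → ℕ → ℝ}
    (hw : ∀ᶠ i in l, ∀ j : ℕ, y i * j ≤ w i j ∧ w i j ≤ y i * j + η i j)
    (hη : ∀ j, Tendsto (fun i => η i j) l (𝓝 0)) :
    Tendsto (fun i => Real.log (∑' j, Real.exp (-w i j))) l
      (𝓝 (Real.log ((1 - Real.exp (-y₀))⁻¹))) := by
  have hpos : (0 : ℝ) < (1 - Real.exp (-y₀))⁻¹ := inv_pos.mpr (by
    have := exp_neg_lt_one hy₀
    linarith)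
  refine Tendsto.log ?_ hpos.ne'
  rw [← tsum_exp_neg_nat_mul hy₀]
  refine tendsto_tsum_of_dominated_convergence (summable_exp_neg_nat_mul (half_pos hy₀))
    (fun j => ?_) ?_
  · refine (Real.continuous_exp.tendsto _).comp (Tendsto.neg ?_)
    have h1 : Tendsto (fun i => y i * j) l (𝓝 (y₀ * j)) := hy.mul_const _
    have h2 : Tendsto (fun i => y i * j + η i j) l (𝓝 (y₀ * j)) := by
      simpa using h1.add (hη j)
    exact tendsto_of_tendsto_of_tendsto_of_le_of_le' h1 h2 (hw.mono fun i h => (h j).1)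
      (hw.mono fun i h => (h j).2)
  · filter_upwards [hw, hy.eventually (lt_mem_nhds (half_lt_self hy₀))] with i h1 h2 j
    rw [Real.norm_eq_abs, abs_of_pos (Real.exp_pos _), Real.exp_le_exp, neg_le_neg_iff]
    refine le_trans ?_ (h1 j).1
    gcongr

/-! ### The thermodynamic limit for independent modes -/

/-- The logarithm of the partition function of the mode `k`. -/
noncomputable def logMode {d : ℕ} (θ : ℝ) (w : Mode d → ℕ → ℝ) (k : Mode d) : ℝ :=
  Real.log (∑' j, Real.exp (-(θ⁻¹ * w k j)))

theorem kinetic_eq {d : ℕ} (hbar m : ℝ) (q : EuclideanSpace ℝ (Fin d)) :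
    kinetic hbar m q = hbar ^ 2 / (2 * m) * ‖q‖ ^ 2 := by
  unfold kinetic; ring

theorem continuous_kinetic {d : ℕ} (hbar m : ℝ) :
    Continuous (kinetic hbar m : EuclideanSpace ℝ (Fin d) → ℝ) := by
  unfold kinetic; fun_prop

theorem kinetic_pos {d : ℕ} {hbar m : ℝ} (hhbar : 0 < hbar) (hm : 0 < m)
    {q : EuclideanSpace ℝ (Fin d)} (hq : q ≠ 0) : 0 < kinetic hbar m q := by
  have := norm_pos_iff.mpr hq
  unfold kinetic; positivity

theorem momentum_ne_zero {d : ℕ} {L : ℝ} (hL : 0 < L) {k : Mode d} (hk : k ≠ 0) :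
    momentum L k ≠ 0 := by
  intro h0
  have h1 := two_pi_div_sq_le_norm_sq (L := L) hk
  rw [h0, norm_zero] at h1
  have : 0 < (2 * Real.pi / L) ^ 2 := by have := Real.pi_pos; positivity
  norm_num at h1
  linarith

theorem cell_zero {d : ℕ} (L : ℝ) : cell (d := d) L 0 = 0 := by
  ext i
  simp [cell]

/-- The pressure of the modes `k ≠ 0` converges to the pressure of the perfect gas, whatever the
asymptotically negligible repulsion inside the modes. -/
theorem tendsto_sum_logMode {d : ℕ} (hd : 2 < d) {hbar m θ α : ℝ} (hhbar : 0 < hbar) (hm : 0 < m)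
    (hθ : 0 < θ) (hα : α ≤ 0) {w : ℝ → Mode d → ℕ → ℝ} {η : ℝ → ℕ → ℝ}
    (hw : ∀ᶠ L in atTop, ∀ k ≠ 0, ∀ j : ℕ, (kinetic hbar m (momentum L k) - α) * j ≤ w L k j ∧
      w L k j ≤ (kinetic hbar m (momentum L k) - α) * j + η L j)
    (hw0 : ∀ᶠ L in atTop, ∀ k, w L k 0 = 0)
    (hη : ∀ j, Tendsto (fun L => η L j) atTop (𝓝 0)) :
    (∀ᶠ L in atTop, Summable fun k => if k = 0 then 0 else logMode θ (w L) k) ∧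
      Tendsto (fun L => 1 / (θ⁻¹ * L ^ d) * ∑' k, if k = 0 then 0 else logMode θ (w L) k) atTop
        (𝓝 (perfectPressure d hbar m θ α)) := by
  have hβ : 0 < θ⁻¹ := inv_pos.mpr hθ
  -- The factor `2(d+1)` is that of `norm_sq_le_of_cell_ne_zero`: outside the zero cell, `κ‖q‖²`
  -- lies below the reduced energy of the cell's mode, even for `α = 0`.
  set κ : ℝ := θ⁻¹ * (hbar ^ 2 / (2 * m)) / (2 * (d + 1)) with hκ
  have hκpos : 0 < κ := by positivity
  have key := tendsto_lattice_sum (d := d)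
    (a := fun L k => if k = 0 then 0 else logMode θ (w L) k)
    (f := fun q => Real.log ((1 - Real.exp (-(θ⁻¹ * (kinetic hbar m q - α))))⁻¹))
    (integrable_exp_neg_div_norm_sq hd (half_pos hκpos) κ) ?_ ?_
  · refine ⟨key.1, ?_⟩
    have h1 := key.2.const_mul θ
    rw [perfectPressure, if_neg hθ.ne']
    have e1 : θ * (1 / (2 * Real.pi) ^ d * ∫ q : EuclideanSpace ℝ (Fin d),
          Real.log ((1 - Real.exp (-(θ⁻¹ * (kinetic hbar m q - α))))⁻¹))
        = 1 / (θ⁻¹ * (2 * Real.pi) ^ d) * ∫ k : EuclideanSpace ℝ (Fin d),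
          Real.log ((1 - Real.exp (-θ⁻¹ * (kinetic hbar m k - α)))⁻¹) := by
      simp_rw [neg_mul]
      have := Real.pi_pos
      field_simp
    rw [← e1]
    refine h1.congr fun L => ?_
    rw [one_div, one_div, mul_inv, inv_inv, mul_assoc]
  · filter_upwards [hw, hw0, eventually_gt_atTop 0] with L h1 h0 hL q
    by_cases hc : cell L q = 0
    · simp only [hc, if_true, abs_zero]
      positivity
    · have hq : q ≠ 0 := fun h => hc (by rw [h, cell_zero])
      have hqn : 0 < ‖q‖ := norm_pos_iff.mpr hq
      have hkp := kinetic_pos hhbar hm (momentum_ne_zero hL hc)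
      set y := θ⁻¹ * (kinetic hbar m (momentum L (cell L q)) - α) with hy
      have hyκ : κ * ‖q‖ ^ 2 ≤ y := by
        have h2 := norm_sq_le_of_cell_ne_zero hL hc
        have h3 : κ * ‖q‖ ^ 2 ≤ κ * (2 * (d + 1) * ‖momentum L (cell L q)‖ ^ 2) := by gcongr
        have h4 : κ * (2 * (d + 1) * ‖momentum L (cell L q)‖ ^ 2)
            = θ⁻¹ * kinetic hbar m (momentum L (cell L q)) := by
          rw [kinetic_eq, hκ]; field_simp
        rw [h4] at h3
        refine h3.trans ?_
        rw [hy]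
        exact mul_le_mul_of_nonneg_left (by linarith) hβ.le
      have hypos : 0 < y := lt_of_lt_of_le (by positivity) hyκ
      have hwy : ∀ j : ℕ, y * j ≤ θ⁻¹ * w L (cell L q) j := fun j => by
        rw [hy, mul_assoc]
        exact mul_le_mul_of_nonneg_left (h1 _ hc j).1 hβ.le
      have hw00 : θ⁻¹ * w L (cell L q) 0 = 0 := by rw [h0, mul_zero]
      rw [if_neg hc, logMode, abs_of_nonneg (Real.log_nonneg
        (one_le_tsum_exp_neg hw00 (summable_exp_neg hypos hwy)))]
      refine (log_tsum_exp_neg_le hypos hw00 hwy).trans ((log_inv_one_sub_exp_le hypos).trans ?_)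
      have h5 : κ / 2 * ‖q‖ ^ 2 ≤ y / 2 := by linarith
      gcongr
  -- The origin stays in the zero cell, whose term is left out, for every `L`; any other point
  -- eventually leaves that cell.
  · have hne : ∀ᵐ q : EuclideanSpace ℝ (Fin d), q ≠ 0 := by
      have : Nonempty (Fin d) := ⟨⟨0, by omega⟩⟩
      rw [ae_iff]
      simp
    filter_upwards [hne] with q hq
    have hmom := tendsto_momentum_cell q
    have hcell : ∀ᶠ L in atTop, cell L q ≠ 0 := by
      filter_upwards [hmom.eventually (isOpen_ne.mem_nhds hq)] with L hL h0
      apply hL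
      rw [h0]
      ext i
      simp [momentum]
    have hlim := tendsto_log_tsum_exp_neg (l := atTop)
      (y := fun L : ℝ => θ⁻¹ * (kinetic hbar m (momentum L (cell L q)) - α))
      (y₀ := θ⁻¹ * (kinetic hbar m q - α)) (w := fun L j => θ⁻¹ * w L (cell L q) j)
      (η := fun L j => θ⁻¹ * η L j)
      (mul_pos hβ (by have := kinetic_pos hhbar hm hq; linarith))
      ((((continuous_kinetic hbar m).tendsto q).comp hmom |>.sub_const α).const_mul _)
      (by
        filter_upwards [hw, hcell] with L h1 h2 j
        obtain ⟨h3, h4⟩ := h1 _ h2 j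
        refine ⟨?_, ?_⟩
        · rw [mul_assoc]; exact mul_le_mul_of_nonneg_left h3 hβ.le
        · rw [mul_assoc, ← mul_add]; exact mul_le_mul_of_nonneg_left h4 hβ.le)
      (fun j => by simpa using (hη j).const_mul θ⁻¹)
    refine hlim.congr' ?_
    filter_upwards [hcell] with L h2
    rw [if_neg h2, logMode]

/-- Thermodynamic limit of the partition function of independent modes. -/
theorem tendsto_log_partition {d : ℕ} (hd : 2 < d) {hbar m θ α : ℝ} (hhbar : 0 < hbar)
    (hm : 0 < m) (hθ : 0 < θ) (hα : α ≤ 0) {w : ℝ → Mode d → ℕ → ℝ} {η : ℝ → ℕ → ℝ} {p₀ : ℝ}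
    (hw : ∀ᶠ L in atTop, ∀ k ≠ 0, ∀ j : ℕ, (kinetic hbar m (momentum L k) - α) * j ≤ w L k j ∧
      w L k j ≤ (kinetic hbar m (momentum L k) - α) * j + η L j)
    (hw0 : ∀ᶠ L in atTop, ∀ k, w L k 0 = 0)
    (hη : ∀ j, Tendsto (fun L => η L j) atTop (𝓝 0))
    (hs : ∀ᶠ L in atTop, Summable fun j => Real.exp (-(θ⁻¹ * w L 0 j)))
    (hp₀ : Tendsto (fun L => 1 / (θ⁻¹ * L ^ d) * logMode θ (w L) 0) atTop (𝓝 p₀)) :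
    (∀ᶠ L in atTop, ∑' n : Occ d, ENNReal.ofReal (Real.exp (-θ⁻¹ * n.sum (w L)))
        = ENNReal.ofReal (Real.exp (∑' k, logMode θ (w L) k))) ∧
      Tendsto (fun L => 1 / (θ⁻¹ * L ^ d) * ∑' k, logMode θ (w L) k) atTop
        (𝓝 (perfectPressure d hbar m θ α + p₀)) := by
  classical
  have hβ : 0 < θ⁻¹ := inv_pos.mpr hθ
  obtain ⟨h1, h2⟩ := tendsto_sum_logMode hd hhbar hm hθ hα hw hw0 hη
  have hsplit : ∀ L, logMode θ (w L)
      = fun k => (if k = 0 then 0 else logMode θ (w L) k) + (Pi.single 0 (logMode θ (w L) 0) : Mode d → ℝ) k := by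
    intro L
    funext k
    by_cases hk : k = 0
    · subst hk; simp
    · simp [hk]
  have hsingle : ∀ c : ℝ, HasSum (Pi.single (0 : Mode d) c : Mode d → ℝ) c := fun c => hasSum_pi_single 0 c
  have hsum : ∀ᶠ L in atTop, HasSum (logMode θ (w L))
      ((∑' k, if k = 0 then 0 else logMode θ (w L) k) + logMode θ (w L) 0) := by
    filter_upwards [h1] with L hL
    have h3 := hL.hasSum.add (hsingle (logMode θ (w L) 0))
    rwa [← hsplit L] at h3
  refine ⟨?_, ?_⟩
  · filter_upwards [hsum, hs, hw, hw0, eventually_gt_atTop 0] with L h3 h4 h5 h6 hL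
    have h7 := tsum_exp_neg_sum_eq (fun k j => θ⁻¹ * w L k j) (fun k => by simp [h6 k])
      (fun k => ?_) h3.summable
    · unfold logMode
      rw [← h7]
      refine tsum_congr fun n => ?_
      rw [neg_mul, Finsupp.sum, Finsupp.sum, Finset.mul_sum]
    · by_cases hk : k = 0
      · rw [hk]; exact h4
      · refine summable_exp_neg (y := θ⁻¹ * (kinetic hbar m (momentum L k) - α)) ?_ fun j => ?_
        · have := kinetic_pos hhbar hm (momentum_ne_zero hL hk)
          exact mul_pos hβ (by linarith)
        · rw [mul_assoc]; exact mul_le_mul_of_nonneg_left (h5 k hk j).1 hβ.le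
  · refine (h2.add hp₀).congr' ?_
    filter_upwards [hsum] with L h3
    rw [h3.tsum_eq, mul_add]

/-! ### Comparison of pressures -/

theorem le_gibbsPressure_zero {ι : Type*} {V : ℝ} (hV : 0 < V) (W : ι → ℝ) (i : ι) :
    ((-(W i) / V : ℝ) : EReal) ≤ gibbsPressure 0 V W := by
  rw [gibbsPressure, if_pos rfl]
  have h1 : ((-(W i) : ℝ) : EReal) ≤ -⨅ i, (W i : EReal) := by
    rw [EReal.coe_neg, EReal.neg_le_neg_iff]
    exact iInf_le _ i
  have h2 := mul_le_mul_of_nonneg_left h1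
    (EReal.coe_nonneg.mpr (by positivity : (0 : ℝ) ≤ 1 / V))
  rw [← EReal.coe_mul] at h2
  refine le_trans (le_of_eq ?_) h2
  congr 1
  ring

theorem gibbsPressure_zero_le {ι : Type*} {V : ℝ} (hV : 0 < V) {W : ι → ℝ} {x : ℝ}
    (h : ∀ i, -(W i) ≤ V * x) : gibbsPressure 0 V W ≤ x := by
  rw [gibbsPressure, if_pos rfl]
  have h1 : -⨅ i, (W i : EReal) ≤ ((V * x : ℝ) : EReal) := by
    rw [EReal.neg_le, ← EReal.coe_neg]
    exact le_iInf fun i => EReal.coe_le_coe_iff.mpr (by linarith [h i])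
  have h2 := mul_le_mul_of_nonneg_left h1
    (EReal.coe_nonneg.mpr (by positivity : (0 : ℝ) ≤ 1 / V))
  rw [← EReal.coe_mul] at h2
  refine h2.trans (le_of_eq ?_)
  congr 1
  field_simp

theorem gibbsPressure_zero_eq {ι : Type*} {V : ℝ} (hV : 0 < V) (W : ι → ℝ) :
    gibbsPressure 0 V W = ⨆ i, ((-(W i) / V : ℝ) : EReal) := by
  refine le_antisymm ?_ (iSup_le fun i => le_gibbsPressure_zero hV W i)
  rw [← EReal.le_of_forall_lt_iff_le]
  intro z hz
  refine gibbsPressure_zero_le hV fun i => ?_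
  have h1 := (le_iSup (fun i => ((-(W i) / V : ℝ) : EReal)) i).trans hz.le
  rwa [EReal.coe_le_coe_iff, div_le_iff₀ hV, mul_comm] at h1

theorem gibbsPressure_of_tsum_eq {ι : Type*} {θ V : ℝ} (hθ : 0 < θ) {W : ι → ℝ} {x : ℝ}
    (h : ∑' i, ENNReal.ofReal (Real.exp (-θ⁻¹ * W i)) = ENNReal.ofReal (Real.exp x)) :
    gibbsPressure θ V W = ((1 / (θ⁻¹ * V) * x : ℝ) : EReal) := by
  rw [gibbsPressure, if_neg hθ.ne', h, ENNReal.log_ofReal_of_pos (Real.exp_pos _), Real.log_exp,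
    EReal.coe_mul]

/-- Restricting to a part of the states, and raising the energy by at most `V C`, lowers the
pressure by at most `C`. -/
theorem gibbsPressure_le_add {ι ι' : Type*} {θ V : ℝ} (hθ : 0 ≤ θ) (hV : 0 < V) {W : ι → ℝ}
    {W' : ι' → ℝ} {f : ι' → ι} (hf : Function.Injective f) {C : ℝ}
    (h : ∀ i, W (f i) ≤ W' i + V * C) : gibbsPressure θ V W' ≤ gibbsPressure θ V W + C := by
  rcases hθ.eq_or_lt with rfl | hθ
  · rw [gibbsPressure_zero_eq hV, gibbsPressure_zero_eq hV]
    refine iSup_le fun i => ?_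
    refine le_trans ?_ (add_le_add_left (le_iSup (fun i => ((-(W i) / V : ℝ) : EReal)) (f i)) _)
    rw [← EReal.coe_add, EReal.coe_le_coe_iff, div_add' _ _ _ hV.ne']
    gcongr
    linarith [h i]
  · have hβ : 0 < θ⁻¹ := inv_pos.mpr hθ
    have h1 : ∑' i, ENNReal.ofReal (Real.exp (-θ⁻¹ * W' i))
        ≤ (∑' i, ENNReal.ofReal (Real.exp (-θ⁻¹ * W i)))
          * ENNReal.ofReal (Real.exp (θ⁻¹ * (V * C))) := by
      rw [← ENNReal.tsum_mul_right]
      refine le_trans ?_ (ENNReal.tsum_comp_le_tsum_of_injective hf _)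
      refine ENNReal.tsum_le_tsum fun i => ?_
      rw [← ENNReal.ofReal_mul (Real.exp_pos _).le, ← Real.exp_add]
      refine ENNReal.ofReal_le_ofReal (Real.exp_le_exp.mpr ?_)
      have := mul_le_mul_of_nonneg_left (h i) hβ.le
      linarith
    have h2 := ENNReal.log_monotone h1
    rw [ENNReal.log_mul_add, ENNReal.log_ofReal_of_pos (Real.exp_pos _), Real.log_exp] at h2
    have h3 : (0 : EReal) ≤ ((1 / (θ⁻¹ * V) : ℝ) : EReal) := EReal.coe_nonneg.mpr (by positivity)
    have h4 := mul_le_mul_of_nonneg_left h2 h3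
    rw [EReal.left_distrib_of_nonneg_of_ne_top h3 (EReal.coe_ne_top _), ← EReal.coe_mul] at h4
    rw [gibbsPressure, gibbsPressure, if_neg hθ.ne', if_neg hθ.ne']
    refine h4.trans (le_of_eq ?_)
    congr 2
    field_simp

/-! ### The zero mode -/

/-- `sup_{ρ ≥ 0} (cρ - g₀ρ²/2)`, the pressure of the zero mode. -/
noncomputable def condensatePressure (g₀ c : ℝ) : ℝ := max c 0 ^ 2 / (2 * g₀)

theorem le_condensatePressure {g₀ : ℝ} (hg₀ : 0 < g₀) (c : ℝ) {x : ℝ} (hx : 0 ≤ x) :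
    c * x - g₀ * x ^ 2 / 2 ≤ condensatePressure g₀ c := by
  rw [condensatePressure, le_div_iff₀ (by positivity)]
  have h1 : c * x ≤ max c 0 * x := mul_le_mul_of_nonneg_right (le_max_left _ _) hx
  nlinarith [sq_nonneg (g₀ * x - max c 0)]

theorem condensatePressure_eq {g₀ : ℝ} (hg₀ : 0 < g₀) (c : ℝ) :
    c * (max c 0 / g₀) - g₀ * (max c 0 / g₀) ^ 2 / 2 = condensatePressure g₀ c := by
  have h1 : c * max c 0 = max c 0 ^ 2 := by
    rcases le_total c 0 with h | h
    · rw [max_eq_right h]; simp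
    · rw [max_eq_left h]; ring
  rw [condensatePressure, mul_div_assoc', h1]
  field_simp
  ring

theorem continuous_condensatePressure (g₀ : ℝ) : Continuous (condensatePressure g₀) := by
  unfold condensatePressure; fun_prop

/-- The infimum is attained at the condensate density `max (α - ε₀) 0 / g₀`. -/
theorem bzPressure_eq (d : ℕ) (hbar m ε₀ θ α : ℝ) {g₀ : ℝ} (hg₀ : 0 < g₀) :
    bzPressure d hbar m ε₀ g₀ θ α
      = perfectPressure d hbar m θ α + condensatePressure g₀ (α - ε₀) := by
  have hle : ∀ ρ : Set.Ici (0 : ℝ), -condensatePressure g₀ (α - ε₀)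
      ≤ (ε₀ - α) * (ρ : ℝ) + g₀ * (ρ : ℝ) ^ 2 / 2 := fun ρ => by
    have := le_condensatePressure hg₀ (α - ε₀) ρ.2
    linarith
  have h : ⨅ ρ₀ : Set.Ici (0 : ℝ), ((ε₀ - α) * (ρ₀ : ℝ) + g₀ * (ρ₀ : ℝ) ^ 2 / 2)
      = -condensatePressure g₀ (α - ε₀) := by
    apply le_antisymm
    · have hρ : max (α - ε₀) 0 / g₀ ∈ Set.Ici (0 : ℝ) :=
        div_nonneg (le_max_right _ _) hg₀.le
      refine (ciInf_le ⟨_, Set.forall_mem_range.mpr hle⟩ ⟨_, hρ⟩).trans (le_of_eq ?_)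
      have := condensatePressure_eq hg₀ (α - ε₀)
      linarith
    · exact le_ciInf hle
  rw [bzPressure, h, sub_neg_eq_add]

/-- The energy of `j` particles in the zero mode of `H^BZ - αN`, in the volume `V`. -/
noncomputable def condensateEnergy (ε₀ g₀ α V : ℝ) (j : ℕ) : ℝ :=
  (ε₀ - α) * j + g₀ / (2 * V) * ((j : ℝ) * ((j : ℝ) - 1))

/-- Raising the chemical potential by `δ` frees a term `-δj`, which makes the Boltzmann factors
summable at a cost continuous in `δ`. The shift `g₀/(2V)` compensates for `j(j-1)` in place of `j²`.
-/
theorem neg_condensateEnergy_le {g₀ V : ℝ} (hg₀ : 0 < g₀) (hV : 0 < V) (ε₀ α δ : ℝ) (j : ℕ) :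
    -condensateEnergy ε₀ g₀ α V j
      ≤ V * condensatePressure g₀ (α - ε₀ + δ + g₀ / (2 * V)) - δ * j := by
  have h1 := le_condensatePressure hg₀ (α - ε₀ + δ + g₀ / (2 * V))
    (by positivity : (0 : ℝ) ≤ (j : ℝ) / V)
  have h2 := mul_le_mul_of_nonneg_left h1 hV.le
  have h3 : V * ((α - ε₀ + δ + g₀ / (2 * V)) * ((j : ℝ) / V) - g₀ * ((j : ℝ) / V) ^ 2 / 2)
      = -condensateEnergy ε₀ g₀ α V j + δ * j := by
    unfold condensateEnergy
    field_simp
    ring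
  linarith

theorem tendsto_condensatePressure (g₀ c : ℝ) {ι : Type*} {l : Filter ι} {V : ι → ℝ}
    (hV : Tendsto V l atTop) :
    Tendsto (fun i => condensatePressure g₀ (c + g₀ / (2 * V i))) l
      (𝓝 (condensatePressure g₀ c)) := by
  refine ((continuous_condensatePressure g₀).tendsto c).comp ?_
  have h1 : Tendsto (fun i => g₀ / (2 * V i)) l (𝓝 0) :=
    tendsto_const_nhds.div_atTop (hV.const_mul_atTop (by norm_num))
  simpa using tendsto_const_nhds.add h1

/-- The macroscopic occupation of the zero mode that minimizes its energy. -/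
theorem tendsto_neg_condensateEnergy {g₀ : ℝ} (hg₀ : 0 < g₀) (ε₀ α : ℝ) {ι : Type*}
    {l : Filter ι} {V : ι → ℝ} (hV : Tendsto V l atTop) :
    Tendsto (fun i => -condensateEnergy ε₀ g₀ α (V i) ⌊max (α - ε₀) 0 / g₀ * V i⌋₊ / V i) l
      (𝓝 (condensatePressure g₀ (α - ε₀))) := by
  set ρ := max (α - ε₀) 0 / g₀ with hρ
  have hρ0 : 0 ≤ ρ := div_nonneg (le_max_right _ _) hg₀.le
  have h1 : Tendsto (fun i => (⌊ρ * V i⌋₊ : ℝ) / V i) l (𝓝 ρ) :=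
    (tendsto_nat_floor_mul_div_atTop hρ0).comp hV
  have h2 : Tendsto (fun i => g₀ / (2 * V i)) l (𝓝 0) :=
    tendsto_const_nhds.div_atTop (hV.const_mul_atTop (by norm_num))
  have h3 := ((h1.const_mul (α - ε₀)).sub (((h1.pow 2).const_mul g₀).div_const 2)).add (h2.mul h1)
  rw [hρ, condensatePressure_eq hg₀, ← hρ, zero_mul, add_zero] at h3
  refine h3.congr' ?_
  filter_upwards [hV.eventually_gt_atTop 0] with i hi
  unfold condensateEnergy
  field_simp
  ring

theorem summable_exp_condensateEnergy {g₀ V β : ℝ} (hg₀ : 0 < g₀) (hV : 0 < V) (hβ : 0 < β)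
    (ε₀ α : ℝ) {δ : ℝ} (hδ : 0 < δ) :
    (Summable fun j => Real.exp (-(β * condensateEnergy ε₀ g₀ α V j))) ∧
      Real.log (∑' j, Real.exp (-(β * condensateEnergy ε₀ g₀ α V j)))
        ≤ β * V * condensatePressure g₀ (α - ε₀ + δ + g₀ / (2 * V))
          + Real.log ((1 - Real.exp (-(β * δ)))⁻¹) := by
  have hb : ∀ j : ℕ, Real.exp (-(β * condensateEnergy ε₀ g₀ α V j))
      ≤ Real.exp (β * V * condensatePressure g₀ (α - ε₀ + δ + g₀ / (2 * V)))
        * Real.exp (-(β * δ * j)) := fun j => by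
    rw [← Real.exp_add, Real.exp_le_exp]
    have := mul_le_mul_of_nonneg_left (neg_condensateEnergy_le hg₀ hV ε₀ α δ j) hβ.le
    linarith
  have hs2 := (summable_exp_neg_nat_mul (mul_pos hβ hδ)).mul_left
    (Real.exp (β * V * condensatePressure g₀ (α - ε₀ + δ + g₀ / (2 * V))))
  have hs1 := hs2.of_nonneg_of_le (fun _ => (Real.exp_pos _).le) hb
  refine ⟨hs1, ?_⟩
  have h0 : condensateEnergy ε₀ g₀ α V 0 = 0 := by simp [condensateEnergy]
  have hle := hs1.tsum_le_tsum hb hs2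
  rw [tsum_mul_left, tsum_exp_neg_nat_mul (mul_pos hβ hδ)] at hle
  have h1 := exp_neg_lt_one (mul_pos hβ hδ)
  have hp : (0 : ℝ) < (1 - Real.exp (-(β * δ)))⁻¹ := inv_pos.mpr (by linarith)
  have h2 := Real.log_le_log (zero_lt_one.trans_le (one_le_tsum_exp_neg (by simp [h0]) hs1)) hle
  rwa [Real.log_mul (Real.exp_pos _).ne' hp.ne', Real.log_exp] at h2

/-- Laplace principle. From below, the single term with the optimal occupation suffices. From above,
the tilt by `δ` leaves a geometric series whose logarithm is bounded in `V`, and then `δ` is taken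
small. -/
theorem tendsto_log_condensate {g₀ θ : ℝ} (hg₀ : 0 < g₀) (hθ : 0 < θ) (ε₀ α : ℝ) {ι : Type*}
    {l : Filter ι} {V : ι → ℝ} (hV : Tendsto V l atTop) :
    Tendsto (fun i => 1 / (θ⁻¹ * V i) *
      Real.log (∑' j, Real.exp (-(θ⁻¹ * condensateEnergy ε₀ g₀ α (V i) j)))) l
      (𝓝 (condensatePressure g₀ (α - ε₀))) := by
  have hβ : 0 < θ⁻¹ := inv_pos.mpr hθ
  rw [tendsto_order]
  constructor
  · intro a ha
    filter_upwards [(tendsto_neg_condensateEnergy hg₀ ε₀ α hV).eventually (lt_mem_nhds ha),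
      hV.eventually_gt_atTop 0] with i h1 hi
    refine h1.trans_le ?_
    set j₀ := ⌊max (α - ε₀) 0 / g₀ * V i⌋₊
    have hs := (summable_exp_condensateEnergy hg₀ hi hβ ε₀ α one_pos).1
    have h2 := Real.log_le_log (Real.exp_pos _)
      (hs.le_tsum j₀ fun _ _ => (Real.exp_pos _).le)
    rw [Real.log_exp] at h2
    have h3 := mul_le_mul_of_nonneg_left h2 (by positivity : 0 ≤ 1 / (θ⁻¹ * V i))
    refine le_trans (le_of_eq ?_) h3
    field_simp
  · intro a ha
    have hcont : Tendsto (fun δ => condensatePressure g₀ (α - ε₀ + δ)) (𝓝[>] 0)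
        (𝓝 (condensatePressure g₀ (α - ε₀))) := by
      have h1 : Continuous fun δ => condensatePressure g₀ (α - ε₀ + δ) :=
        (continuous_condensatePressure g₀).comp (continuous_const.add continuous_id)
      have h2 := (h1.tendsto 0).mono_left (nhdsWithin_le_nhds (s := Set.Ioi 0))
      simpa using h2
    obtain ⟨δ, hδa, hδ⟩ := ((hcont.eventually (gt_mem_nhds ha)).and self_mem_nhdsWithin).exists
    have hδ' : (0 : ℝ) < δ := hδ
    have h3 : Tendsto (fun i => condensatePressure g₀ (α - ε₀ + δ + g₀ / (2 * V i))
        + Real.log ((1 - Real.exp (-(θ⁻¹ * δ)))⁻¹) / (θ⁻¹ * V i)) l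
        (𝓝 (condensatePressure g₀ (α - ε₀ + δ))) := by
      have h4 : Tendsto (fun i => Real.log ((1 - Real.exp (-(θ⁻¹ * δ)))⁻¹) / (θ⁻¹ * V i)) l
          (𝓝 0) := tendsto_const_nhds.div_atTop (hV.const_mul_atTop hβ)
      simpa using (tendsto_condensatePressure g₀ (α - ε₀ + δ) hV).add h4
    filter_upwards [h3.eventually (gt_mem_nhds hδa), hV.eventually_gt_atTop 0] with i h5 hi
    refine lt_of_le_of_lt ?_ h5
    have h6 := (summable_exp_condensateEnergy hg₀ hi hβ ε₀ α hδ').2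
    have h7 := mul_le_mul_of_nonneg_left h6 (by positivity : 0 ≤ 1 / (θ⁻¹ * V i))
    refine h7.trans (le_of_eq ?_)
    field_simp

/-! ### The thermodynamic limit of `H^BZ` -/

/-- For `V ≥ 1` the power bounds combine into `g_k(V)/V ≤ γ₊ V^(α₊-1)`, uniformly in `k`, and `α₊ <
1`. -/
theorem AdmissibleCouplings.eventually {d : ℕ} (hd : 2 < d) {gk : Mode d → ℝ → ℝ}
    (h : AdmissibleCouplings gk) :
    ∃ η : ℝ → ℝ, Tendsto η atTop (𝓝 0) ∧ ∀ᶠ L : ℝ in atTop, ∀ k, k ≠ 0 →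
      0 ≤ 1 / L ^ d * gk k (L ^ d) ∧ 1 / L ^ d * gk k (L ^ d) ≤ η L := by
  obtain ⟨gminus, γplus, αplus, V₀, γ, a, hg, hα, hV₀, h⟩ := h
  have hpow : Tendsto (fun L : ℝ => L ^ d) atTop atTop := tendsto_pow_atTop (by omega)
  refine ⟨fun L => γplus * (L ^ d) ^ (αplus - 1), ?_, ?_⟩
  · have h1 := (tendsto_rpow_neg_atTop (by linarith : 0 < 1 - αplus)).comp hpow
    have h2 := h1.const_mul γplus
    simp only [neg_sub, mul_zero] at h2
    exact h2
  · filter_upwards [hpow.eventually_ge_atTop V₀, hpow.eventually_ge_atTop 1] with L h1 h2 k hk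
    obtain ⟨h3, h4, h5, h6⟩ := h k hk
    obtain ⟨h7, h8⟩ := h6 _ h1
    have hV : (0 : ℝ) < L ^ d := by linarith
    refine ⟨mul_nonneg (by positivity) (hg.le.trans h7), ?_⟩
    have h9 : gk k (L ^ d) ≤ γplus * (L ^ d) ^ αplus := by
      refine h8.trans (mul_le_mul h4 (Real.rpow_le_rpow_of_exponent_le h2 h5) (by positivity) ?_)
      exact h3.le.trans h4
    rw [Real.rpow_sub_one hV.ne', one_div, inv_mul_eq_div, ← mul_div_assoc]
    gcongr

/-- The weight of the single modes in `H^BZ - αN`. -/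
noncomputable def bzShifted {d : ℕ} (hbar m ε₀ g₀ : ℝ) (gk : Mode d → ℝ → ℝ) (α L : ℝ)
    (k : Mode d) (j : ℕ) : ℝ :=
  bzWeight hbar m ε₀ g₀ gk L k j - α * j

theorem sum_sub_mul_particles {d : ℕ} (w : Mode d → ℕ → ℝ) (α : ℝ) (n : Occ d) :
    n.sum w - α * particles n = n.sum fun k j => w k j - α * j := by
  simp only [particles, Finsupp.sum, Nat.cast_sum, Finset.mul_sum, Finset.sum_sub_distrib]

theorem bzShifted_zero {d : ℕ} (hbar m ε₀ g₀ : ℝ) (gk : Mode d → ℝ → ℝ) (α L : ℝ) (j : ℕ) :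
    bzShifted hbar m ε₀ g₀ gk α L 0 j = condensateEnergy ε₀ g₀ α (L ^ d) j := by
  rw [bzShifted, bzWeight, if_pos rfl, condensateEnergy]; ring

theorem nat_mul_sub_one_nonneg (j : ℕ) : (0 : ℝ) ≤ (j : ℝ) * ((j : ℝ) - 1) := by
  rcases Nat.eq_zero_or_pos j with rfl | h
  · simp
  · have : (1 : ℝ) ≤ j := by exact_mod_cast h
    exact mul_nonneg (by linarith) (by linarith)

theorem tendsto_pressure_bzHamiltonian {d : ℕ} (hd : 2 < d) {hbar m ε₀ g₀ : ℝ}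
    (hhbar : 0 < hbar) (hm : 0 < m) (hg₀ : 0 < g₀) {gk : Mode d → ℝ → ℝ}
    (hgk : AdmissibleCouplings gk) {θ : ℝ} (hθ : 0 ≤ θ) {α : ℝ} (hα : α ≤ 0) :
    Tendsto (fun L : ℝ => pressure θ L α (bzHamiltonian d hbar m ε₀ g₀ gk L)) atTop
      (𝓝 ((bzPressure d hbar m ε₀ g₀ θ α : ℝ) : EReal)) := by
  have hpow : Tendsto (fun L : ℝ => L ^ d) atTop atTop := tendsto_pow_atTop (by omega)
  obtain ⟨η, hη, hgη⟩ := hgk.eventually hd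
  have e1 : ∀ L, pressure θ L α (bzHamiltonian d hbar m ε₀ g₀ gk L)
      = gibbsPressure θ (L ^ d) fun n : Occ d => n.sum (bzShifted hbar m ε₀ g₀ gk α L) := fun L => by
    rw [pressure_eq_gibbsPressure (isDiagonal_bzHamiltonian d hbar m ε₀ g₀ gk L)]
    simp only [sum_sub_mul_particles]
    rfl
  have hw : ∀ᶠ L in atTop, ∀ k ≠ 0, ∀ j : ℕ,
      (kinetic hbar m (momentum L k) - α) * j ≤ bzShifted hbar m ε₀ g₀ gk α L k j ∧
      bzShifted hbar m ε₀ g₀ gk α L k j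
        ≤ (kinetic hbar m (momentum L k) - α) * j + η L * ((j : ℝ) * ((j : ℝ) - 1)) := by
    filter_upwards [hgη] with L h k hk j
    obtain ⟨h1, h2⟩ := h k hk
    have hj := nat_mul_sub_one_nonneg j
    have h3 := mul_nonneg h1 hj
    have h4 := mul_le_mul_of_nonneg_right h2 hj
    rw [bzShifted, bzWeight, if_neg hk]
    constructor <;> linarith
  simp_rw [e1]
  rw [bzPressure_eq d hbar m ε₀ θ α hg₀]
  rcases hθ.eq_or_lt with rfl | hθ
  · rw [perfectPressure, if_pos rfl, zero_add]
    refine tendsto_of_tendsto_of_tendsto_of_le_of_le'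
      (EReal.tendsto_coe.mpr (tendsto_neg_condensateEnergy hg₀ ε₀ α hpow))
      (EReal.tendsto_coe.mpr (tendsto_condensatePressure g₀ (α - ε₀) hpow)) ?_ ?_
    · filter_upwards [eventually_gt_atTop 0] with L hL
      have h1 := le_gibbsPressure_zero (pow_pos hL d)
        (fun n : Occ d => n.sum (bzShifted hbar m ε₀ g₀ gk α L))
        (Finsupp.single 0 ⌊max (α - ε₀) 0 / g₀ * L ^ d⌋₊)
      rwa [Finsupp.sum_single_index (by simp [bzShifted_zero, condensateEnergy]),
        bzShifted_zero] at h1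
    · filter_upwards [eventually_gt_atTop 0, hw] with L hL h1
      refine gibbsPressure_zero_le (pow_pos hL d) fun n => ?_
      -- At zero temperature there is no sum over `j` to control, so no tilt is needed. The modes `k
      -- ≠ 0` have nonnegative energy for `α ≤ 0` and are dropped.
      have h2 := neg_condensateEnergy_le hg₀ (pow_pos hL d) ε₀ α 0 (n 0)
      rw [add_zero, zero_mul, sub_zero] at h2
      refine le_trans (neg_le_neg ?_) h2
      rw [← sum_ite_eq_zero n (condensateEnergy ε₀ g₀ α (L ^ d)) (by simp [condensateEnergy])]
      refine Finset.sum_le_sum fun k _ => ?_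
      by_cases hk : k = 0
      · simp [hk, bzShifted_zero]
      · simp only [hk, if_false]
        refine le_trans (mul_nonneg ?_ (Nat.cast_nonneg _)) (h1 k hk _).1
        linarith [kinetic_nonneg hbar hm (momentum L k)]
  · have h0 : ∀ L, logMode θ (bzShifted hbar m ε₀ g₀ gk α L) 0
        = Real.log (∑' j, Real.exp (-(θ⁻¹ * condensateEnergy ε₀ g₀ α (L ^ d) j))) := fun L => by
      simp only [logMode, bzShifted_zero]
    obtain ⟨h1, h2⟩ := tendsto_log_partition hd hhbar hm hθ hα hw
      (Eventually.of_forall fun L k => by simp [bzShifted, bzWeight])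
      (fun j => by simpa using hη.mul_const ((j : ℝ) * ((j : ℝ) - 1)))
      (by
        filter_upwards [eventually_gt_atTop 0] with L hL
        simp only [bzShifted_zero]
        exact (summable_exp_condensateEnergy hg₀ (pow_pos hL d) (inv_pos.mpr hθ) ε₀ α one_pos).1)
      (by simp_rw [h0]; exact tendsto_log_condensate hg₀ hθ ε₀ α hpow)
    refine (EReal.tendsto_coe.mpr h2).congr' ?_
    filter_upwards [h1] with L h3
    rw [gibbsPressure_of_tsum_eq hθ h3]

/-! ### Upper bound for the toy model -/

theorem bzWeight_le_toyWeight {d : ℕ} (hbar m ε₀ : ℝ) {g₀ g L : ℝ} (hg₀ : 0 < g₀) (hg : 0 < g)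
    (hL : 0 < L) (k : Mode d) (j : ℕ) :
    bzWeight hbar m ε₀ g₀ (fun _ _ => g / 2) L k j ≤ toyWeight hbar m ε₀ g₀ g L k j := by
  have hj : (0 : ℝ) ≤ j := Nat.cast_nonneg _
  have hV : 0 < L ^ d := pow_pos hL d
  have hjj : (j : ℝ) * ((j : ℝ) - 1) ≤ (j : ℝ) ^ 2 := by nlinarith
  unfold bzWeight toyWeight
  split_ifs
  · gcongr
  · have e : 1 / L ^ d * (g / 2 * ((j : ℝ) * ((j : ℝ) - 1)))
        = g / (2 * L ^ d) * ((j : ℝ) * ((j : ℝ) - 1)) := by field_simp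
    rw [e]
    gcongr

/-- The mean-field term is linearized by completing the square in `N`. The coupling `g/2` is chosen
so that `(g/2V) j(j-1)` lies below the repulsion `(g/2V) j²` of the toy model. -/
theorem pressure_toy_le {d : ℕ} (hbar m ε₀ μ α : ℝ) {g₀ g lam θ L : ℝ} (hg₀ : 0 < g₀) (hg : 0 < g)
    (hlam : 0 < lam) (hθ : 0 ≤ θ) (hL : 0 < L) :
    pressure θ L μ (toyHamiltonian d hbar m ε₀ g₀ lam g L)
      ≤ pressure θ L α (bzHamiltonian d hbar m ε₀ g₀ (fun _ _ => g / 2) L)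
        + (((μ - α) ^ 2 / (2 * lam) : ℝ) : EReal) := by
  have hV : 0 < L ^ d := pow_pos hL d
  rw [pressure_eq_gibbsPressure (isDiagonal_toyHamiltonian d hbar m ε₀ g₀ lam g L),
    pressure_eq_gibbsPressure (isDiagonal_bzHamiltonian d hbar m ε₀ g₀ _ L)]
  refine gibbsPressure_le_add hθ hV (f := id) Function.injective_id fun n => ?_
  have h1 : n.sum (bzWeight hbar m ε₀ g₀ (fun _ _ => g / 2) L)
      ≤ n.sum (toyWeight hbar m ε₀ g₀ g L) :=
    Finset.sum_le_sum fun k _ => bzWeight_le_toyWeight hbar m ε₀ hg₀ hg hL k _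
  have h2 : 0 ≤ (lam * particles n - L ^ d * (μ - α)) ^ 2 / (2 * L ^ d * lam) := by positivity
  have h3 : (lam * particles n - L ^ d * (μ - α)) ^ 2 / (2 * L ^ d * lam)
      = lam / (2 * L ^ d) * (particles n : ℝ) ^ 2 - (μ - α) * particles n
        + L ^ d * ((μ - α) ^ 2 / (2 * lam)) := by
    field_simp
    ring
  simp only [id]
  linarith

/-! ### Differentiability of the pressure of the perfect gas -/

theorem integrable_exp_neg_mul_norm_sq {d : ℕ} (hd : 2 < d) {b : ℝ} (hb : 0 < b) :
    Integrable fun q : EuclideanSpace ℝ (Fin d) => Real.exp (-(b * ‖q‖ ^ 2)) := by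
  have : Nonempty (Fin d) := ⟨⟨0, by omega⟩⟩
  rw [integrable_fun_norm_addHaar volume
    (f := fun y : ℝ => Real.exp (-(b * y ^ 2))), finrank_euclideanSpace, Fintype.card_fin]
  have h1 := integrableOn_rpow_mul_exp_neg_mul_sq hb (s := ((d - 1 : ℕ) : ℝ)) (by
    have : (0 : ℝ) ≤ ((d - 1 : ℕ) : ℝ) := Nat.cast_nonneg _
    linarith)
  refine (integrableOn_congr_fun (fun y hy => ?_) measurableSet_Ioi).mp h1
  simp only [smul_eq_mul]
  rw [Real.rpow_natCast, neg_mul]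

/-- Differentiation under the integral: away from `α = 0` the Bose occupation factor is dominated by
a Gaussian. The derivative is the density of the perfect gas. -/
theorem exists_hasDerivAt_perfectPressure {d : ℕ} (hd : 2 < d) {hbar m : ℝ} (hhbar : 0 < hbar)
    (hm : 0 < m) {θ : ℝ} (hθ : 0 ≤ θ) {α : ℝ} (hα : α < 0) :
    ∃ ρ, 0 ≤ ρ ∧ HasDerivAt (perfectPressure d hbar m θ) ρ α := by
  rcases hθ.eq_or_lt with rfl | hθ
  · refine ⟨0, le_rfl, ?_⟩
    have : perfectPressure d hbar m 0 = fun _ => (0 : ℝ) := by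
      funext μ; simp [perfectPressure]
    rw [this]
    exact hasDerivAt_const _ _
  have hβ : 0 < θ⁻¹ := inv_pos.mpr hθ
  set β := θ⁻¹ with hβdef
  let F : ℝ → EuclideanSpace ℝ (Fin d) → ℝ := fun a k =>
    Real.log ((1 - Real.exp (-β * (kinetic hbar m k - a)))⁻¹)
  let F' : ℝ → EuclideanSpace ℝ (Fin d) → ℝ := fun a k =>
    β * Real.exp (-β * (kinetic hbar m k - a)) / (1 - Real.exp (-β * (kinetic hbar m k - a)))
  have hkin := (continuous_kinetic (d := d) hbar m).measurable
  have hlt : ∀ a < 0, ∀ k : EuclideanSpace ℝ (Fin d),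
      0 < 1 - Real.exp (-β * (kinetic hbar m k - a)) := fun a ha k => by
    have h1 := kinetic_nonneg hbar hm k
    have h2 := exp_neg_lt_one (mul_pos hβ (by linarith : 0 < kinetic hbar m k - a))
    rw [← neg_mul] at h2
    linarith
  have hexp : ∀ q : EuclideanSpace ℝ (Fin d),
      Real.exp (-(β * kinetic hbar m q)) = Real.exp (-(β * (hbar ^ 2 / (2 * m)) * ‖q‖ ^ 2)) :=
    fun q => by rw [kinetic_eq]; ring_nf
  have hgauss : Integrable fun q : EuclideanSpace ℝ (Fin d) =>
      Real.exp (-(β * kinetic hbar m q)) := by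
    simp_rw [hexp]
    exact integrable_exp_neg_mul_norm_sq hd (by positivity)
  have hgauss2 : Integrable fun q : EuclideanSpace ℝ (Fin d) =>
      Real.exp (-(β * kinetic hbar m q / 2)) := by
    have h1 : ∀ q : EuclideanSpace ℝ (Fin d), Real.exp (-(β * kinetic hbar m q / 2))
        = Real.exp (-(β * (hbar ^ 2 / (2 * m)) / 2 * ‖q‖ ^ 2)) :=
      fun q => by rw [kinetic_eq]; ring_nf
    simp_rw [h1]
    exact integrable_exp_neg_mul_norm_sq hd (by positivity)
  have hFm : ∀ a, Measurable (F a) := fun a => by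
    have h1 : Measurable fun k : EuclideanSpace ℝ (Fin d) =>
      (1 - Real.exp (-β * (kinetic hbar m k - a)))⁻¹ := by fun_prop
    exact Real.measurable_log.comp h1
  have hF'm : ∀ a, Measurable (F' a) := fun a => by
    change Measurable fun k : EuclideanSpace ℝ (Fin d) =>
      β * Real.exp (-β * (kinetic hbar m k - a)) / (1 - Real.exp (-β * (kinetic hbar m k - a)))
    fun_prop
  have hFint : Integrable (F α) := by
    refine (hgauss2.const_mul (1 / (-(β * α)))).mono' (hFm α).aestronglyMeasurable
      (Eventually.of_forall fun k => ?_)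
    have hk := kinetic_nonneg hbar hm k
    have hpos : 0 < 1 - Real.exp (-β * (kinetic hbar m k - α)) := hlt α hα k
    have hone : (1 : ℝ) ≤ (1 - Real.exp (-β * (kinetic hbar m k - α)))⁻¹ := by
      rw [one_le_inv₀ hpos]
      linarith [Real.exp_pos (-β * (kinetic hbar m k - α))]
    rw [Real.norm_eq_abs, abs_of_nonneg (Real.log_nonneg hone)]
    have hy : 0 < β * (kinetic hbar m k - α) := mul_pos hβ (by linarith)
    have h1 := log_inv_one_sub_exp_le hy
    rw [← neg_mul] at h1
    refine h1.trans ?_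
    have hba : 0 < -(β * α) := by have := mul_neg_of_pos_of_neg hβ hα; linarith
    have hbk : 0 ≤ β * kinetic hbar m k := mul_nonneg hβ.le hk
    rw [div_eq_mul_one_div, mul_comm]
    refine mul_le_mul ?_ (Real.exp_le_exp.mpr ?_) (Real.exp_pos _).le (by positivity)
    · exact one_div_le_one_div_of_le hba (by linarith)
    · linarith
  have hC : 0 < 1 - Real.exp (β * (α / 2)) := by
    have := exp_neg_lt_one (mul_pos hβ (by linarith : 0 < -(α / 2)))
    rw [mul_neg, neg_neg] at this
    linarith
  have hderiv : ∀ a < 0, ∀ k, HasDerivAt (fun a => F a k) (F' a k) a := fun a ha k => by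
    have h1 : HasDerivAt (fun a => 1 - Real.exp (-β * (kinetic hbar m k - a)))
        (-(Real.exp (-β * (kinetic hbar m k - a)) * (-β * (-1)))) a :=
      ((((hasDerivAt_id a).const_sub _).const_mul (-β)).exp).const_sub 1
    have h2 := (h1.log (hlt a ha k).ne').neg
    have h3 : (fun a => F a k) = -fun a => Real.log (1 - Real.exp (-β * (kinetic hbar m k - a))) := by
      funext a; simp [F, Real.log_inv]
    rw [h3]
    have h4 : F' a k = -(-(Real.exp (-β * (kinetic hbar m k - a)) * (-β * (-1)))
        / (1 - Real.exp (-β * (kinetic hbar m k - a)))) := by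
      change β * Real.exp (-β * (kinetic hbar m k - a))
        / (1 - Real.exp (-β * (kinetic hbar m k - a))) = _
      ring
    rwa [h4]
  -- Restricting to `a < α/2` keeps the denominator above `1 - e^{βα/2}`, uniformly in `k`.
  have hbound : ∀ᵐ k : EuclideanSpace ℝ (Fin d), ∀ a ∈ Set.Iio (α / 2),
      ‖F' a k‖ ≤ β / (1 - Real.exp (β * (α / 2))) * Real.exp (-(β * kinetic hbar m k)) := by
    refine Eventually.of_forall fun k a ha => ?_
    have ha2 : a < α / 2 := ha
    have ha0 : a < 0 := by linarith
    have hk := mul_nonneg hβ.le (kinetic_nonneg hbar hm k)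
    have hpos := hlt a ha0 k
    rw [Real.norm_eq_abs, abs_of_nonneg (div_nonneg (by positivity) hpos.le), mul_comm (_ / _),
      mul_div_assoc', mul_comm _ β]
    have h1 : β * a < β * (α / 2) := mul_lt_mul_of_pos_left ha2 hβ
    have h2 : β * a < 0 := mul_neg_of_pos_of_neg hβ ha0
    refine div_le_div₀ (by positivity) (mul_le_mul_of_nonneg_left (Real.exp_le_exp.mpr ?_) hβ.le)
      hC (sub_le_sub_left (Real.exp_le_exp.mpr ?_) 1)
    · linarith
    · linarith
  obtain ⟨hint, hd'⟩ := hasDerivAt_integral_of_dominated_loc_of_deriv_le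
    (Iio_mem_nhds (by linarith : α < α / 2)) (Eventually.of_forall fun a => (hFm a).aestronglyMeasurable)
    hFint (hF'm α).aestronglyMeasurable hbound (hgauss.const_mul _)
    (Eventually.of_forall fun k a ha => hderiv a (by
      have : a < α / 2 := ha
      linarith) k)
  have hfun : perfectPressure d hbar m θ = fun a => 1 / (β * (2 * Real.pi) ^ d) * ∫ k, F a k := by
    funext a
    rw [perfectPressure, if_neg hθ.ne']
  have hpi := Real.pi_pos
  refine ⟨1 / (β * (2 * Real.pi) ^ d) * ∫ k, F' α k, mul_nonneg (by positivity)
    (integral_nonneg fun k => div_nonneg (by positivity) (hlt α hα k).le), ?_⟩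
  rw [hfun]
  exact hd'.const_mul _

theorem perfectPressure_nonneg {d : ℕ} (hbar : ℝ) {m : ℝ} (hm : 0 < m) {θ : ℝ} (hθ : 0 ≤ θ)
    {α : ℝ} (hα : α ≤ 0) : 0 ≤ perfectPressure d hbar m θ α := by
  rw [perfectPressure]
  split_ifs with h0
  · exact le_rfl
  · have hβ : 0 ≤ θ⁻¹ := inv_nonneg.mpr hθ
    have hpi := Real.pi_pos
    refine mul_nonneg (by positivity) (integral_nonneg fun k => ?_)
    have h1 : Real.exp (-θ⁻¹ * (kinetic hbar m k - α)) ≤ 1 := by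
      rw [Real.exp_le_one_iff]
      have := mul_nonneg hβ (by linarith [kinetic_nonneg hbar hm k] : 0 ≤ kinetic hbar m k - α)
      linarith
    have h2 := Real.exp_pos (-θ⁻¹ * (kinetic hbar m k - α))
    change 0 ≤ Real.log _
    rw [Real.log_inv, neg_nonneg]
    exact Real.log_nonpos (by linarith) (by linarith)

/-! ### Concentration of the particle density -/

/-- The single-mode weights of a gas with a repulsion `(g/V) j²` in every mode, at chemical
potential `α`. -/
noncomputable def thermalWeight {d : ℕ} (hbar m g α L : ℝ) (k : Mode d) (j : ℕ) : ℝ :=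
  (kinetic hbar m (momentum L k) - α) * j + g / L ^ d * (j : ℝ) ^ 2

/-- The zero mode has no binding energy here. For `α < 0` its logarithm stays bounded and disappears
after division by the volume, hence `p₀ = 0`. -/
theorem tendsto_log_thermal {d : ℕ} (hd : 2 < d) {hbar m θ α g : ℝ} (hhbar : 0 < hbar)
    (hm : 0 < m) (hθ : 0 < θ) (hα : α < 0) (hg : 0 < g) :
    (∀ᶠ L in atTop, ∑' n : Occ d,
        ENNReal.ofReal (Real.exp (-θ⁻¹ * n.sum (thermalWeight hbar m g α L)))
        = ENNReal.ofReal (Real.exp (∑' k, logMode θ (thermalWeight (d := d) hbar m g α L) k))) ∧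
      Tendsto (fun L => 1 / (θ⁻¹ * L ^ d) *
        ∑' k, logMode θ (thermalWeight (d := d) hbar m g α L) k) atTop
        (𝓝 (perfectPressure d hbar m θ α)) := by
  have hβ : 0 < θ⁻¹ := inv_pos.mpr hθ
  have hpow : Tendsto (fun L : ℝ => L ^ d) atTop atTop := tendsto_pow_atTop (by omega)
  have hy : 0 < θ⁻¹ * -α := mul_pos hβ (by linarith)
  have hzero : ∀ᶠ L : ℝ in atTop, ∀ j : ℕ,
      θ⁻¹ * -α * j ≤ θ⁻¹ * thermalWeight (d := d) hbar m g α L 0 j := by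
    filter_upwards [eventually_gt_atTop 0] with L hL j
    have hk := kinetic_nonneg hbar hm (momentum (d := d) L 0)
    have h1 : 0 ≤ kinetic hbar m (momentum (d := d) L 0) * j := by positivity
    have h2 : 0 ≤ g / L ^ d * (j : ℝ) ^ 2 := by positivity
    rw [mul_assoc]
    refine mul_le_mul_of_nonneg_left ?_ hβ.le
    unfold thermalWeight
    linarith
  have h := tendsto_log_partition hd hhbar hm hθ hα.le (w := thermalWeight hbar m g α)
    (η := fun L j => g / L ^ d * (j : ℝ) ^ 2) (p₀ := 0) ?_ ?_ ?_ ?_ ?_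
  · simpa using h
  · filter_upwards [eventually_gt_atTop 0] with L hL k _ j
    refine ⟨?_, le_rfl⟩
    have : 0 ≤ g / L ^ d * (j : ℝ) ^ 2 := by positivity
    unfold thermalWeight
    linarith
  · exact Eventually.of_forall fun L k => by simp [thermalWeight]
  · intro j
    have h1 : Tendsto (fun L : ℝ => g / L ^ d) atTop (𝓝 0) := tendsto_const_nhds.div_atTop hpow
    simpa using h1.mul_const ((j : ℝ) ^ 2)
  · exact hzero.mono fun L hL => summable_exp_neg hy hL
  · have h1 : Tendsto (fun L : ℝ => 1 / (θ⁻¹ * L ^ d) *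
        Real.log ((1 - Real.exp (-(θ⁻¹ * -α)))⁻¹)) atTop (𝓝 0) := by
      have h2 : Tendsto (fun L : ℝ => 1 / (θ⁻¹ * L ^ d)) atTop (𝓝 0) :=
        tendsto_const_nhds.div_atTop (hpow.const_mul_atTop hβ)
      simpa using h2.mul_const (Real.log ((1 - Real.exp (-(θ⁻¹ * -α)))⁻¹))
    refine squeeze_zero' ?_ ?_ h1
    · filter_upwards [hzero, eventually_gt_atTop 0] with L h2 hL
      exact mul_nonneg (by positivity) (Real.log_nonneg
        (one_le_tsum_exp_neg (by simp [thermalWeight]) (summable_exp_neg hy h2)))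
    · filter_upwards [hzero, eventually_gt_atTop 0] with L h2 hL
      exact mul_le_mul_of_nonneg_left (log_tsum_exp_neg_le hy (by simp [thermalWeight]) h2)
        (by positivity)

theorem sum_thermalWeight_shift {d : ℕ} (hbar m g α t L : ℝ) (n : Occ d) :
    n.sum (thermalWeight hbar m g (α + t) L)
      = n.sum (thermalWeight hbar m g α L) - t * particles n := by
  rw [sum_sub_mul_particles]
  refine Finset.sum_congr rfl fun k _ => ?_
  unfold thermalWeight
  ring

/-- Chernoff bound: the partition function is carried by the states with density close to `ρ`, up to
two exponentially tilted partition functions. -/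
theorem thermal_partition_le {d : ℕ} (hbar m g α ρ δ : ℝ) {β t L : ℝ} (hβ : 0 < β) (ht : 0 < t)
    (hL : 0 < L) :
    ∑' n : Occ d, ENNReal.ofReal (Real.exp (-β * n.sum (thermalWeight hbar m g α L)))
      ≤ ∑' n : {n : Occ d // |(particles n : ℝ) / L ^ d - ρ| ≤ δ},
          ENNReal.ofReal (Real.exp (-β * n.1.sum (thermalWeight hbar m g α L)))
        + ENNReal.ofReal (Real.exp (-(β * L ^ d * (t * (ρ + δ))))) *
          ∑' n : Occ d, ENNReal.ofReal (Real.exp (-β * n.sum (thermalWeight hbar m g (α + t) L)))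
        + ENNReal.ofReal (Real.exp (β * L ^ d * (t * (ρ - δ)))) *
          ∑' n : Occ d,
            ENNReal.ofReal (Real.exp (-β * n.sum (thermalWeight hbar m g (α + -t) L))) := by
  have hV : 0 < L ^ d := pow_pos hL d
  have hsub := tsum_subtype {n : Occ d | |(particles n : ℝ) / L ^ d - ρ| ≤ δ}
    fun n => ENNReal.ofReal (Real.exp (-β * n.sum (thermalWeight hbar m g α L)))
  rw [← ENNReal.tsum_mul_left, ← ENNReal.tsum_mul_left]
  refine le_trans ?_ (add_le_add_left (add_le_add_left hsub.ge _) _)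
  rw [← ENNReal.tsum_add, ← ENNReal.tsum_add]
  refine ENNReal.tsum_le_tsum fun n => ?_
  by_cases hn : |(particles n : ℝ) / L ^ d - ρ| ≤ δ
  · rw [Set.indicator_of_mem (by exact hn)]
    exact le_self_add.trans le_self_add
  · rw [Set.indicator_of_notMem (by exact hn), zero_add]
    rw [not_le, lt_abs] at hn
    simp_rw [sum_thermalWeight_shift]
    rw [← ENNReal.ofReal_mul (Real.exp_pos _).le, ← ENNReal.ofReal_mul (Real.exp_pos _).le,
      ← Real.exp_add, ← Real.exp_add]
    have hc : 0 < β * t := mul_pos hβ ht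
    -- States that are too dense are charged to the tilt `+t`, too dilute ones to `-t`; in each case
    -- the extra exponential factor is at least `1`.
    rcases hn with hn | hn
    · refine le_trans (ENNReal.ofReal_le_ofReal (Real.exp_le_exp.mpr ?_)) le_self_add
      have h1 : ρ + δ < (particles n : ℝ) / L ^ d := by linarith
      rw [lt_div_iff₀ hV] at h1
      have h2 := mul_le_mul_of_nonneg_left h1.le hc.le
      linarith
    · refine le_trans (ENNReal.ofReal_le_ofReal (Real.exp_le_exp.mpr ?_)) le_add_self
      have h1 : (particles n : ℝ) / L ^ d < ρ - δ := by linarith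
      rw [div_lt_iff₀ hV] at h1
      have h2 := mul_le_mul_of_nonneg_left h1.le hc.le
      linarith

/-- The first-order expansion has an error of at most `δt/2`, which the gain `δt` beats on both
sides. This makes both Chernoff tails exponentially small. -/
theorem exists_tilt {f : ℝ → ℝ} {ρ α δ : ℝ} (hα : α < 0) (hf : HasDerivAt f ρ α) (hδ : 0 < δ) :
    ∃ t > 0, α + t < 0 ∧ f (α + t) - t * (ρ + δ) < f α ∧ f (α + -t) + t * (ρ - δ) < f α := by
  have h1 : ∀ᶠ h in 𝓝 (0 : ℝ), ‖f (α + h) - f α - h • ρ‖ ≤ δ / 2 * ‖h‖ :=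
    (hasDerivAt_iff_isLittleO_nhds_zero.mp hf).def (half_pos hδ)
  have h2 : ∀ᶠ h in 𝓝 (0 : ℝ), ‖f (α + -h) - f α - (-h) • ρ‖ ≤ δ / 2 * ‖-h‖ := by
    have : Tendsto (fun h : ℝ => -h) (𝓝 0) (𝓝 0) := by
      simpa using (continuous_neg.tendsto (0 : ℝ))
    exact this.eventually h1
  have h3 : ∀ᶠ h in 𝓝 (0 : ℝ), α + h < 0 := by
    have : Tendsto (fun h : ℝ => α + h) (𝓝 0) (𝓝 α) := by
      have hc : Continuous fun h : ℝ => α + h := by fun_prop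
      simpa using hc.tendsto 0
    exact this.eventually (gt_mem_nhds hα)
  obtain ⟨t, ⟨⟨h4, h5⟩, h6⟩, ht⟩ := ((((h1.and h2).and h3).filter_mono
    (nhdsWithin_le_nhds (s := Set.Ioi 0))).and self_mem_nhdsWithin).exists
  have ht' : (0 : ℝ) < t := ht
  have h7 := mul_pos ht' hδ
  rw [Real.norm_eq_abs, Real.norm_eq_abs, abs_of_pos ht', smul_eq_mul] at h4
  rw [Real.norm_eq_abs, Real.norm_eq_abs, abs_neg, abs_of_pos ht', smul_eq_mul] at h5
  refine ⟨t, ht', h6, ?_, ?_⟩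
  · have := (abs_le.mp h4).2
    linarith
  · have := (abs_le.mp h5).2
    linarith

/-- The states with density close to `ρ = ∂p^P/∂α` carry the whole pressure. -/
theorem eventually_le_thermal_pressure {d : ℕ} (hd : 2 < d) {hbar m θ α g ρ δ x : ℝ}
    (hhbar : 0 < hbar) (hm : 0 < m) (hθ : 0 ≤ θ) (hα : α < 0) (hg : 0 < g)
    (hρ : HasDerivAt (perfectPressure d hbar m θ) ρ α) (hδ : 0 < δ)
    (hx : x < perfectPressure d hbar m θ α) :
    ∀ᶠ L in atTop, (x : EReal) ≤ gibbsPressure θ (L ^ d)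
      fun n : {n : Occ d // |(particles n : ℝ) / L ^ d - ρ| ≤ δ} =>
        n.1.sum (thermalWeight hbar m g α L) := by
  rcases hθ.eq_or_lt with rfl | hθ
  · have hf : perfectPressure d hbar m 0 = fun _ => (0 : ℝ) := by
      funext μ; simp [perfectPressure]
    rw [hf] at hρ hx
    have hρ0 : ρ = 0 := hρ.unique (hasDerivAt_const _ _)
    filter_upwards [eventually_gt_atTop 0] with L hL
    refine le_trans ?_ (le_gibbsPressure_zero (pow_pos hL d) _
      ⟨0, by simpa [particles, hρ0] using hδ.le⟩)
    rw [EReal.coe_le_coe_iff]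
    simpa using hx.le
  have hβ : 0 < θ⁻¹ := inv_pos.mpr hθ
  have hpow : Tendsto (fun L : ℝ => L ^ d) atTop atTop := tendsto_pow_atTop (by omega)
  obtain ⟨t, ht, hαt, h1, h2⟩ := exists_tilt hα hρ hδ
  obtain ⟨z1, z2⟩ := tendsto_log_thermal hd hhbar hm hθ hα hg
  obtain ⟨p1, p2⟩ := tendsto_log_thermal hd hhbar hm hθ hαt hg
  obtain ⟨m1, m2⟩ := tendsto_log_thermal hd hhbar hm hθ (by linarith : α + -t < 0) hg
  have hc : ∀ c : ℝ, Tendsto (fun L : ℝ => 1 / (θ⁻¹ * L ^ d) * c) atTop (𝓝 0) := fun c => by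
    have h : Tendsto (fun L : ℝ => 1 / (θ⁻¹ * L ^ d)) atTop (𝓝 0) :=
      tendsto_const_nhds.div_atTop (hpow.const_mul_atTop hβ)
    simpa using h.mul_const c
  -- The `log 4` makes each tail at most a quarter of the whole partition function, so the density
  -- window keeps at least half.
  have hp := ((p2.sub_const (t * (ρ + δ))).add (hc (Real.log 4))).eventually_lt z2
    (by rw [add_zero]; exact h1)
  have hm' := ((m2.add_const (t * (ρ - δ))).add (hc (Real.log 4))).eventually_lt z2
    (by rw [add_zero]; exact h2)
  have hz := (tendsto_const_nhds (x := x)).eventually_lt (z2.sub (hc (Real.log 2)))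
    (by rw [sub_zero]; exact hx)
  filter_upwards [z1, p1, m1, hp, hm', hz, eventually_gt_atTop 0] with L z1 p1 m1 hp hm' hz hL
  have hV : 0 < θ⁻¹ * L ^ d := mul_pos hβ (pow_pos hL d)
  have hch := thermal_partition_le (d := d) hbar m g α ρ δ hβ ht hL
  rw [z1, p1, m1, ← ENNReal.ofReal_mul (Real.exp_pos _).le,
    ← ENNReal.ofReal_mul (Real.exp_pos _).le, ← Real.exp_add, ← Real.exp_add] at hch
  set z := ∑' k, logMode θ (thermalWeight (d := d) hbar m g α L) k
  set zp := ∑' k, logMode θ (thermalWeight (d := d) hbar m g (α + t) L) k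
  set zm := ∑' k, logMode θ (thermalWeight (d := d) hbar m g (α + -t) L) k
  set T := ∑' n : {n : Occ d // |(particles n : ℝ) / L ^ d - ρ| ≤ δ},
    ENNReal.ofReal (Real.exp (-θ⁻¹ * n.1.sum (thermalWeight hbar m g α L))) with hT
  have hmul : ∀ a b : ℝ, 1 / (θ⁻¹ * L ^ d) * a < 1 / (θ⁻¹ * L ^ d) * b → a < b := fun a b h =>
    lt_of_mul_lt_mul_left h (by positivity)
  have hp' : -(θ⁻¹ * L ^ d * (t * (ρ + δ))) + zp < z - Real.log 4 := by
    refine hmul _ _ ?_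
    have e : 1 / (θ⁻¹ * L ^ d) * (-(θ⁻¹ * L ^ d * (t * (ρ + δ))) + zp)
      = 1 / (θ⁻¹ * L ^ d) * zp - t * (ρ + δ) := by field_simp; ring
    rw [e, mul_sub]
    linarith
  have hm'' : θ⁻¹ * L ^ d * (t * (ρ - δ)) + zm < z - Real.log 4 := by
    refine hmul _ _ ?_
    have e : 1 / (θ⁻¹ * L ^ d) * (θ⁻¹ * L ^ d * (t * (ρ - δ)) + zm)
      = 1 / (θ⁻¹ * L ^ d) * zm + t * (ρ - δ) := by field_simp; ring
    rw [e, mul_sub]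
    linarith
  have e4 : Real.exp (z - Real.log 4) = Real.exp z / 4 := by
    rw [Real.exp_sub, Real.exp_log (by norm_num)]
  have hhalf : ENNReal.ofReal (Real.exp (z - Real.log 2)) ≤ T := by
    rw [Real.exp_sub, Real.exp_log (by norm_num)]
    have h3 : ENNReal.ofReal (Real.exp z) ≤ T + ENNReal.ofReal (Real.exp z / 2) := by
      refine hch.trans ?_
      rw [add_assoc]
      gcongr
      rw [← ENNReal.ofReal_add (Real.exp_pos _).le (Real.exp_pos _).le]
      refine ENNReal.ofReal_le_ofReal ?_
      have h5 := Real.exp_le_exp.mpr hp'.le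
      have h6 := Real.exp_le_exp.mpr hm''.le
      rw [e4] at h5 h6
      linarith
    have h4 : Real.exp z = Real.exp z / 2 + Real.exp z / 2 := by ring
    rw [h4, ENNReal.ofReal_add (by positivity) (by positivity)] at h3
    simp only [add_halves] at h3
    exact (ENNReal.add_le_add_iff_right ENNReal.ofReal_ne_top).mp h3
  have hlog := ENNReal.log_monotone hhalf
  rw [ENNReal.log_ofReal_of_pos (Real.exp_pos _), Real.log_exp] at hlog
  have h7 := mul_le_mul_of_nonneg_left hlog
    (EReal.coe_nonneg.mpr (by positivity : (0 : ℝ) ≤ 1 / (θ⁻¹ * L ^ d)))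
  rw [gibbsPressure, if_neg hθ.ne']
  refine le_trans ?_ h7
  rw [← EReal.coe_mul, EReal.coe_le_coe_iff, mul_sub]
  exact hz.le

/-! ### Lower bound for the toy model -/

/-- The occupation with `r` particles in the zero mode and `j` particles in each mode of `K`. -/
noncomputable def condensate {d : ℕ} (r : ℕ) (K : Finset (Mode d)) (j : ℕ) : Occ d :=
  Finsupp.single 0 r + ∑ k ∈ K, Finsupp.single k j

theorem condensate_zero {d : ℕ} (r : ℕ) {K : Finset (Mode d)} (hK : 0 ∉ K) (j : ℕ) :
    condensate r K j 0 = r := by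
  have : ∀ k ∈ K, (Finsupp.single k j : Occ d) 0 = 0 := fun k hk =>
    Finsupp.single_eq_of_ne fun h => hK (h ▸ hk)
  rw [condensate, Finsupp.add_apply, Finsupp.finsetSum_apply, Finset.sum_eq_zero this]
  simp

theorem condensate_apply {d : ℕ} (r : ℕ) {K : Finset (Mode d)} (j : ℕ) {k : Mode d}
    (hk : k ∈ K) (hk0 : k ≠ 0) : condensate r K j k = j := by
  classical
  rw [condensate, Finsupp.add_apply, Finsupp.finsetSum_apply, Finsupp.single_eq_of_ne hk0,
    zero_add, Finset.sum_eq_single k (fun b _ hb => Finsupp.single_eq_of_ne hb.symm)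
    (fun h => absurd hk h), Finsupp.single_eq_same]

theorem sum_condensate {d : ℕ} {M : Type*} [AddCommMonoid M] (r : ℕ) {K : Finset (Mode d)}
    (hK : 0 ∉ K) (j : ℕ) (w : Mode d → ℕ → M) (hw : ∀ k, w k 0 = 0) :
    (condensate r K j).sum w = w 0 r + ∑ k ∈ K, w k j := by
  classical
  have hsupp : (condensate r K j).support ⊆ insert 0 K := by
    intro k hk
    rw [Finset.mem_insert]
    by_contra! hcon
    rw [Finsupp.mem_support_iff] at hk
    apply hk
    rw [condensate, Finsupp.add_apply, Finsupp.finsetSum_apply,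
      Finsupp.single_eq_of_ne hcon.1, Finset.sum_eq_zero, zero_add]
    intro b hb
    exact Finsupp.single_eq_of_ne fun h => hcon.2 (h ▸ hb)
  rw [Finsupp.sum_of_support_subset _ hsupp _ fun k _ => hw k, Finset.sum_insert hK,
    condensate_zero r hK]
  congr 1
  refine Finset.sum_congr rfl fun k hk => ?_
  rw [condensate_apply r j hk fun h => hK (h ▸ hk)]

theorem sum_add_le {d : ℕ} (n s : Occ d) {w w₁ w₂ : Mode d → ℕ → ℝ} (h0 : ∀ k, w k 0 = 0)
    (h1 : ∀ k, w₁ k 0 = 0) (h2 : ∀ k, w₂ k 0 = 0)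
    (h : ∀ k, w k (n k + s k) ≤ w₁ k (n k) + w₂ k (s k)) :
    (n + s).sum w ≤ n.sum w₁ + s.sum w₂ := by
  classical
  rw [Finsupp.sum_of_support_subset (n + s) Finsupp.support_add w fun k _ => h0 k,
    Finsupp.sum_of_support_subset n Finset.subset_union_left w₁ fun k _ => h1 k,
    Finsupp.sum_of_support_subset s Finset.subset_union_right w₂ fun k _ => h2 k,
    ← Finset.sum_add_distrib]
  exact Finset.sum_le_sum fun k _ => h k

theorem particles_add {d : ℕ} (n s : Occ d) : particles (n + s) = particles n + particles s :=
  Finsupp.sum_add_index' (fun _ => rfl) fun _ _ _ => rfl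

/-- The weights of the macroscopically occupied modes. -/
noncomputable def condensateWeight {d : ℕ} (hbar m ε₀ g₀ g L : ℝ) (k : Mode d) (j : ℕ) : ℝ :=
  if k = 0 then ε₀ * j + g₀ / (2 * L ^ d) * (j : ℝ) ^ 2
  else kinetic hbar m (momentum L k) * j + g / L ^ d * (j : ℝ) ^ 2

/-- The energy of a thermal cloud on top of a condensate. -/
theorem sum_toyWeight_add_condensate_le {d : ℕ} (hbar α : ℝ) {m ε₀ g₀ g L : ℝ} (hm : 0 < m)
    (hg₀ : 0 < g₀) (hg : 0 < g) (hL : 0 < L) {r : ℕ} (hr : ε₀ + g₀ * ((r : ℝ) / L ^ d) ≤ 0)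
    {K : Finset (Mode d)} (hK : 0 ∉ K) (j : ℕ) (n : Occ d) :
    (n + condensate r K j).sum (toyWeight hbar m ε₀ g₀ g L)
      ≤ n.sum (thermalWeight hbar m (g + g₀) α L) + α * particles n
        + (condensate r K j).sum (condensateWeight hbar m ε₀ g₀ g L) := by
  have hV : 0 < L ^ d := pow_pos hL d
  have h1 : n.sum (thermalWeight hbar m (g + g₀) α L) + α * particles n
      = n.sum (thermalWeight hbar m (g + g₀) 0 L) := by
    have := sum_thermalWeight_shift hbar m (g + g₀) 0 α L n
    rw [zero_add] at this
    linarith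
  rw [h1]
  refine sum_add_le _ _ (fun k => by simp [toyWeight]) (fun k => by simp [thermalWeight])
    (fun k => by simp [condensateWeight]) fun k => ?_
  have hk := kinetic_nonneg hbar hm (momentum L k)
  by_cases hk0 : k = 0
  · subst hk0
    rw [condensate_zero r hK, toyWeight, thermalWeight, condensateWeight, if_pos rfl, if_pos rfl]
    set x : ℝ := ((n 0 : ℕ) : ℝ) with hx
    have hx0 : 0 ≤ x := Nat.cast_nonneg _
    -- The interaction of the cloud with the condensate in the zero mode is absorbed by the binding
    -- energy `ε₀`.
    have h2 := mul_nonpos_of_nonpos_of_nonneg hr hx0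
    have h3 := mul_nonneg hk hx0
    have h4 : 0 ≤ (2 * g + g₀) / (2 * L ^ d) * x ^ 2 := by positivity
    have h5 : g₀ / (2 * L ^ d) * (x + r) ^ 2
        = (g + g₀) / L ^ d * x ^ 2 - (2 * g + g₀) / (2 * L ^ d) * x ^ 2
          + g₀ * ((r : ℝ) / L ^ d) * x + g₀ / (2 * L ^ d) * (r : ℝ) ^ 2 := by
      field_simp
      ring
    push_cast
    rw [← hx, h5]
    linarith
  · rw [toyWeight, thermalWeight, condensateWeight, if_neg hk0, if_neg hk0]
    set x : ℝ := ((n k : ℕ) : ℝ) with hx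
    set y : ℝ := ((condensate r K j k : ℕ) : ℝ) with hy
    -- The cross term is removed by `(x + y)² ≤ 2x² + 2y²`. This doubles the coefficient, hence `g /
    -- L ^ d` in `condensateWeight` and in the cloud.
    have h4 : 0 ≤ g / (2 * L ^ d) * (x - y) ^ 2 := by positivity
    have h5 : 0 ≤ g₀ / L ^ d * x ^ 2 := by positivity
    have h6 : g / (2 * L ^ d) * (x + y) ^ 2 = (g + g₀) / L ^ d * x ^ 2 - g₀ / L ^ d * x ^ 2
        + g / L ^ d * y ^ 2 - g / (2 * L ^ d) * (x - y) ^ 2 := by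
      field_simp
      ring
    push_cast
    rw [← hx, ← hy, h6]
    linarith

theorem tendsto_kinetic_momentum {d : ℕ} (hbar m : ℝ) (k : Mode d) :
    Tendsto (fun L : ℝ => kinetic hbar m (momentum L k)) atTop (𝓝 0) := by
  have h1 : Tendsto (fun L : ℝ => momentum L k) atTop (𝓝 0) := by
    have h2 : ∀ L : ℝ, momentum L k = (1 / L) • momentum 1 k := fun L => by
      ext i
      simp [momentum]
      ring
    have h3 : Tendsto (fun L : ℝ => 1 / L) atTop (𝓝 0) := tendsto_const_nhds.div_atTop tendsto_id
    refine Tendsto.congr (fun L => (h2 L).symm) ?_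
    simpa using h3.smul_const (momentum 1 k)
  have h4 := ((continuous_kinetic (d := d) hbar m).tendsto 0).comp h1
  simpa [kinetic] using! h4

/-- Here `R` is the total density: cloud, zero mode and an excess `c` in `M` soft modes. Adding a
fixed condensate occupation is injective, so `gibbsPressure_le_add` compares the windowed cloud with
the toy model. The excess earns no factor `-α`, whence `-α(R - c)`. -/
theorem eventually_le_pressure_toy {d : ℕ} (hd : 2 < d) {hbar m ε₀ g₀ g lam θ α μ ρ c y : ℝ}
    (hhbar : 0 < hbar) (hm : 0 < m) (hε₀ : ε₀ < 0) (hg₀ : 0 < g₀) (hg : 0 < g) (hθ : 0 ≤ θ)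
    (hα : α < 0) (hρ : HasDerivAt (perfectPressure d hbar m θ) ρ α) (hc : 0 ≤ c)
    {R : ℝ} (hR : R = max (α - ε₀) 0 / g₀ + ρ + c)
    (hy : y < perfectPressure d hbar m θ α + condensatePressure g₀ (α - ε₀) - α * (R - c)
      + μ * R - lam * R ^ 2 / 2) :
    ∀ᶠ L in atTop, (y : EReal) ≤ pressure θ L μ (toyHamiltonian d hbar m ε₀ g₀ lam g L) := by
  have hpow : Tendsto (fun L : ℝ => L ^ d) atTop atTop := tendsto_pow_atTop (by omega)
  set ρ₀ := max (α - ε₀) 0 / g₀ with hρ₀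
  have hρ₀0 : 0 ≤ ρ₀ := div_nonneg (le_max_right _ _) hg₀.le
  have hcond := condensatePressure_eq hg₀ (α - ε₀)
  rw [← hρ₀] at hcond
  set gap := perfectPressure d hbar m θ α + condensatePressure g₀ (α - ε₀) - α * (R - c)
      + μ * R - lam * R ^ 2 / 2 - y with hgap
  have hgap0 : 0 < gap := by linarith
  -- The slack `gap` is shared in thirds: the repulsion of the excess, the passage to the limit in
  -- volume and density, and the pressure of the cloud.
  obtain ⟨M, hM⟩ := exists_nat_gt (max 1 (3 * g * c ^ 2 / gap))
  have hM1 : (1 : ℝ) < M := (le_max_left _ _).trans_lt hM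
  have hM0 : (0 : ℝ) < M := by linarith
  have hMg : g * c ^ 2 / M < gap / 3 := by
    have h1 := (le_max_right _ _).trans_lt hM
    rw [div_lt_iff₀ hgap0] at h1
    rw [div_lt_iff₀ hM0]
    linarith
  have hne : Nonempty (Fin d) := ⟨⟨0, by omega⟩⟩
  obtain ⟨K, hK1, hK2⟩ := (Set.Finite.infinite_compl (Set.finite_singleton (0 : Mode d))
    ).exists_subset_card_eq M
  have hK : (0 : Mode d) ∉ K := fun h => hK1 h rfl
  let r : ℝ → ℕ := fun L => ⌊ρ₀ * L ^ d⌋₊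
  let j : ℝ → ℕ := fun L => ⌊c / M * L ^ d⌋₊
  have hr : Tendsto (fun L => (r L : ℝ) / L ^ d) atTop (𝓝 ρ₀) :=
    (tendsto_nat_floor_mul_div_atTop hρ₀0).comp hpow
  have hj : Tendsto (fun L => (j L : ℝ) / L ^ d) atTop (𝓝 (c / M)) :=
    (tendsto_nat_floor_mul_div_atTop (div_nonneg hc hM0.le)).comp hpow
  have he : Tendsto (fun L => ∑ k ∈ K, (kinetic hbar m (momentum L k) * ((j L : ℝ) / L ^ d)
      + g * ((j L : ℝ) / L ^ d) ^ 2)) atTop (𝓝 (g * c ^ 2 / M)) := by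
    have h1 := tendsto_finsetSum K fun k _ =>
      ((tendsto_kinetic_momentum hbar m k).mul hj).add ((hj.pow 2).const_mul g)
    have h2 : ∑ k ∈ K, (0 * (c / M) + g * (c / M) ^ 2) = g * c ^ 2 / M := by
      rw [Finset.sum_const, hK2, nsmul_eq_mul]
      field_simp
      ring
    rwa [h2] at h1
  -- The limit is joint in the cloud density and the volume, since the cloud density is only known
  -- to lie in a window; the window width is chosen from this limit.
  have hE : Tendsto (fun p : ℝ × ℝ => α * p.1
        + (ε₀ * ((r p.2 : ℝ) / p.2 ^ d) + g₀ * ((r p.2 : ℝ) / p.2 ^ d) ^ 2 / 2)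
        + (∑ k ∈ K, (kinetic hbar m (momentum p.2 k) * ((j p.2 : ℝ) / p.2 ^ d)
          + g * ((j p.2 : ℝ) / p.2 ^ d) ^ 2))
        + lam * (p.1 + (r p.2 : ℝ) / p.2 ^ d + M * ((j p.2 : ℝ) / p.2 ^ d)) ^ 2 / 2
        - μ * (p.1 + (r p.2 : ℝ) / p.2 ^ d + M * ((j p.2 : ℝ) / p.2 ^ d)))
      (𝓝 ρ ×ˢ atTop)
      (𝓝 (α * ρ + (ε₀ * ρ₀ + g₀ * ρ₀ ^ 2 / 2) + g * c ^ 2 / M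
        + lam * (ρ + ρ₀ + M * (c / M)) ^ 2 / 2 - μ * (ρ + ρ₀ + M * (c / M)))) := by
    have t1 : Tendsto (fun p : ℝ × ℝ => p.1) (𝓝 ρ ×ˢ atTop) (𝓝 ρ) := tendsto_fst
    have t2 := hr.comp (tendsto_snd (f := 𝓝 ρ) (g := (atTop : Filter ℝ)))
    have t3 := hj.comp (tendsto_snd (f := 𝓝 ρ) (g := (atTop : Filter ℝ)))
    have t4 := he.comp (tendsto_snd (f := 𝓝 ρ) (g := (atTop : Filter ℝ)))
    have t5 := (t1.add t2).add (t3.const_mul (M : ℝ))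
    exact ((((t1.const_mul α).add ((t2.const_mul ε₀).add
      (((t2.pow 2).const_mul g₀).div_const 2))).add t4).add
      (((t5.pow 2).const_mul lam).div_const 2)).sub (t5.const_mul μ)
  have hlimit : α * ρ + (ε₀ * ρ₀ + g₀ * ρ₀ ^ 2 / 2) + g * c ^ 2 / M
        + lam * (ρ + ρ₀ + M * (c / M)) ^ 2 / 2 - μ * (ρ + ρ₀ + M * (c / M))
      < perfectPressure d hbar m θ α - y - gap / 3 := by
    have e1 : (M : ℝ) * (c / M) = c := by field_simp
    have e2 : ρ + ρ₀ + c = R := by rw [hR]; ring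
    have e3 : α * ρ = α * (R - c) - α * ρ₀ := by rw [hR]; ring
    rw [e1, e2, e3]
    linarith
  obtain ⟨pa, hpa, pb, hpb, hab⟩ := eventually_prod_iff.mp (hE.eventually (gt_mem_nhds hlimit))
  obtain ⟨δ, hδ, hball⟩ := Metric.eventually_nhds_iff.mp hpa
  have hth := eventually_le_thermal_pressure hd hhbar hm hθ hα (add_pos hg hg₀) hρ (half_pos hδ)
    (x := perfectPressure d hbar m θ α - gap / 3) (by linarith)
  filter_upwards [hth, hpb, eventually_gt_atTop 0] with L h1 h2 hL
  have hV : 0 < L ^ d := pow_pos hL d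
  rw [pressure_eq_gibbsPressure (isDiagonal_toyHamiltonian d hbar m ε₀ g₀ lam g L)]
  -- Rounding down keeps the zero mode below `ρ₀`, and `g₀ρ₀ = max (α - ε₀) 0 ≤ -ε₀` because `α` and
  -- `ε₀` are negative.
  have hrL : ε₀ + g₀ * ((r L : ℝ) / L ^ d) ≤ 0 := by
    have h3 : (r L : ℝ) / L ^ d ≤ ρ₀ := by
      rw [div_le_iff₀ hV]
      exact Nat.floor_le (by positivity)
    have h4 := mul_le_mul_of_nonneg_left h3 hg₀.le
    have h5 : g₀ * ρ₀ = max (α - ε₀) 0 := by rw [hρ₀]; field_simp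
    have h6 : max (α - ε₀) 0 ≤ -ε₀ := max_le (by linarith) (by linarith)
    linarith
  have hcmp := gibbsPressure_le_add (θ := θ) (V := L ^ d)
    (W := fun n : Occ d => n.sum (toyWeight hbar m ε₀ g₀ g L)
      + lam / (2 * L ^ d) * (particles n : ℝ) ^ 2 - μ * particles n)
    (W' := fun n : {n : Occ d // |(particles n : ℝ) / L ^ d - ρ| ≤ δ / 2} =>
      n.1.sum (thermalWeight hbar m (g + g₀) α L))
    (f := fun n => n.1 + condensate (r L) K (j L))
    (C := perfectPressure d hbar m θ α - y - gap / 3) hθ hV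
    (fun a b hab => Subtype.ext (add_right_cancel hab)) ?_
  · have h3 := h1.trans hcmp
    have h4 : ((perfectPressure d hbar m θ α - gap / 3 : ℝ) : EReal)
        = ((y : ℝ) : EReal) + ((perfectPressure d hbar m θ α - y - gap / 3 : ℝ) : EReal) := by
      rw [← EReal.coe_add]; congr 1; ring
    rw [h4] at h3
    exact EReal.addLECancellable_coe _ |>.add_le_add_iff_right.mp h3
  · rintro ⟨n, hn⟩
    have h3 := hab (hball (by rw [Real.dist_eq]; linarith :
      dist ((particles n : ℝ) / L ^ d) ρ < δ)) h2
    have h4 := sum_toyWeight_add_condensate_le hbar α hm hg₀ hg hL hrL hK (j L) n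
    have h5 : (particles (n + condensate (r L) K (j L)) : ℝ)
        = L ^ d * ((particles n : ℝ) / L ^ d + (r L : ℝ) / L ^ d
          + M * ((j L : ℝ) / L ^ d)) := by
      rw [particles_add]
      have : particles (condensate (r L) K (j L)) = r L + M * j L := by
        rw [particles, sum_condensate _ hK _ _ fun _ => rfl, Finset.sum_const, hK2, smul_eq_mul]
      rw [this]
      push_cast
      field_simp
      ring
    have h6 : (condensate (r L) K (j L)).sum (condensateWeight hbar m ε₀ g₀ g L)
        = L ^ d * (ε₀ * ((r L : ℝ) / L ^ d) + g₀ * ((r L : ℝ) / L ^ d) ^ 2 / 2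
          + ∑ k ∈ K, (kinetic hbar m (momentum L k) * ((j L : ℝ) / L ^ d)
            + g * ((j L : ℝ) / L ^ d) ^ 2)) := by
      rw [sum_condensate _ hK _ _ fun k => by simp [condensateWeight], mul_add, Finset.mul_sum]
      congr 1
      · rw [condensateWeight, if_pos rfl]
        field_simp
      · refine Finset.sum_congr rfl fun k hk => ?_
        rw [condensateWeight, if_neg fun h : k = 0 => hK (h ▸ hk)]
        field_simp
    have h7 := mul_le_mul_of_nonneg_left (le_of_lt h3) hV.le
    simp only at h7 ⊢
    rw [h5]
    rw [h6] at h4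
    have h8 : α * (particles n : ℝ) = L ^ d * (α * ((particles n : ℝ) / L ^ d)) := by
      field_simp
    rw [h8] at h4
    set S := ∑ k ∈ K, (kinetic hbar m (momentum L k) * ((j L : ℝ) / L ^ d)
            + g * ((j L : ℝ) / L ^ d) ^ 2)
    set u := (particles n : ℝ) / L ^ d + (r L : ℝ) / L ^ d + M * ((j L : ℝ) / L ^ d)
    have h9 : lam / (2 * L ^ d) * (L ^ d * u) ^ 2 = L ^ d * (lam * u ^ 2 / 2) := by
      field_simp
    rw [h9]
    linarith

/-! ### The variational formula -/

/-- A differentiable function on `(-∞, 0)`, at least `(μ-α)²/(2λ)` and with derivative at least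
`-(μ-α)/λ`, has points of nonpositive derivative with `|α f'(α)|` arbitrarily small. -/
theorem exists_small_slope {f f' : ℝ → ℝ} {lam μ : ℝ} (hlam : 0 < lam)
    (hf : ∀ α < 0, HasDerivAt f (f' α) α) (hlow : ∀ α < 0, (μ - α) ^ 2 / (2 * lam) ≤ f α)
    (hslope : ∀ α < 0, -(μ - α) / lam ≤ f' α) {ε : ℝ} (hε : 0 < ε) :
    ∃ α < 0, f' α ≤ 0 ∧ α * f' α < ε := by
  by_cases hneg : ∀ α < 0, f' α < 0
  -- With no stationary point to use, `α` is taken close to `0`: the lower bound on the slope forces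
  -- `α f'(α)` below a quantity that vanishes there.
  · have ht : Tendsto (fun α : ℝ => α * (-(μ - α) / lam)) (𝓝[<] 0) (𝓝 0) := by
      have h1 : Continuous fun α : ℝ => α * (-(μ - α) / lam) := by fun_prop
      have h2 := (h1.tendsto 0).mono_left (nhdsWithin_le_nhds (s := Set.Iio 0))
      simpa using h2
    obtain ⟨α, h1, h2⟩ := ((ht.eventually (gt_mem_nhds hε)).and self_mem_nhdsWithin).exists
    have h2' : α < 0 := h2
    refine ⟨α, h2', (hneg α h2').le, lt_of_le_of_lt ?_ h1⟩
    exact mul_le_mul_of_nonpos_left (hslope α h2') h2'.le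
  · push Not at hneg
    obtain ⟨b, hb, hfb⟩ := hneg
    obtain ⟨α, hα, hfα⟩ : ∃ α < 0, f' α = 0 := by
      -- Without a zero, Darboux's theorem, which needs no continuity of `f'`, makes `f` monotone on
      -- `(-∞, b]`; this contradicts its quadratic growth at `-∞`.
      by_contra! hne
      have hpos : ∀ α < 0, α ≤ b → 0 ≤ f' α := by
        intro a ha hab
        by_contra! hlt
        have hbne : 0 < f' b := lt_of_le_of_ne hfb (hne b hb).symm
        obtain ⟨x, hx, hx0⟩ := exists_hasDerivWithinAt_eq_of_gt_of_lt hab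
          (fun x hx => (hf x (lt_of_le_of_lt hx.2 hb)).hasDerivWithinAt) hlt hbne
        exact hne x (hx.2.trans hb) hx0
      have hmono : MonotoneOn f (Set.Iic b) := by
        refine monotoneOn_of_hasDerivWithinAt_nonneg (convex_Iic b) (f' := f')
          (fun x hx => (hf x (lt_of_le_of_lt hx hb)).continuousAt.continuousWithinAt)
          (fun x hx => ?_) fun x hx => ?_
        all_goals rw [interior_Iic] at hx
        all_goals have hx' : x < b := hx
        · exact (hf x (hx'.trans hb)).hasDerivWithinAt
        · exact hpos x (hx'.trans hb) hx'.le
      have htop : Tendsto (fun a : ℝ => (μ - a) ^ 2 / (2 * lam)) atBot atTop := by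
        refine Tendsto.atTop_div_const (by positivity) ?_
        refine (tendsto_pow_atTop two_ne_zero).comp ?_
        exact tendsto_atTop_add_const_left _ μ tendsto_neg_atBot_atTop
      obtain ⟨a, ha1, ha2⟩ := ((htop.eventually_gt_atTop (f b)).and (eventually_le_atBot b)).exists
      have h1 := hmono (show a ∈ Set.Iic b from ha2) Set.self_mem_Iic ha2
      have h2 := hlow a (lt_of_le_of_lt ha2 hb)
      linarith
    exact ⟨α, hα, hfα.le, by rw [hfα, mul_zero]; exact hε⟩

/-- The square smooths the kink of the positive part: at `0` it is `O(x²)`. The derivative is the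
optimal condensate density. -/
theorem hasDerivAt_condensatePressure {g₀ : ℝ} (hg₀ : 0 < g₀) (c : ℝ) :
    HasDerivAt (condensatePressure g₀) (max c 0 / g₀) c := by
  have hsq : HasDerivAt (fun x : ℝ => max x 0 ^ 2) (2 * max c 0) c := by
    rcases lt_trichotomy c 0 with hc | rfl | hc
    · rw [max_eq_right hc.le, mul_zero]
      refine (hasDerivAt_const c (0 : ℝ)).congr_of_eventuallyEq ?_
      filter_upwards [gt_mem_nhds hc] with x hx
      rw [max_eq_right hx.le]; simp
    · rw [max_self, mul_zero, hasDerivAt_iff_isLittleO_nhds_zero]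
      simp only [zero_add, max_self, smul_zero, sub_zero, ne_eq, OfNat.ofNat_ne_zero,
        not_false_eq_true, zero_pow]
      rw [Asymptotics.isLittleO_iff]
      intro C hC
      filter_upwards [Metric.ball_mem_nhds (0 : ℝ) hC] with x hx
      rw [mem_ball_zero_iff, Real.norm_eq_abs] at hx
      rw [Real.norm_eq_abs, Real.norm_eq_abs, abs_of_nonneg (sq_nonneg _)]
      have h1 : max x 0 ≤ |x| := max_le (le_abs_self x) (abs_nonneg x)
      have h2 : 0 ≤ max x 0 := le_max_right _ _
      nlinarith [abs_nonneg x]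
    · rw [max_eq_left hc.le]
      have h1 : HasDerivAt (fun x : ℝ => x ^ 2) (2 * c) c := by
        simpa using hasDerivAt_pow 2 c
      refine h1.congr_of_eventuallyEq ?_
      filter_upwards [lt_mem_nhds hc] with x hx
      rw [max_eq_left hx.le]
  have h2 := hsq.div_const (2 * g₀)
  have h3 : 2 * max c 0 / (2 * g₀) = max c 0 / g₀ := by
    field_simp
  rw [h3] at h2
  exact h2

/-- The right-hand side of the variational formula. -/
noncomputable def toyPressure (d : ℕ) (hbar m ε₀ g₀ lam θ μ : ℝ) : ℝ :=
  ⨅ α : Set.Iic (0 : ℝ), (bzPressure d hbar m ε₀ g₀ θ (α : ℝ) + (μ - (α : ℝ)) ^ 2 / (2 * lam))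

theorem sq_div_le_variational {d : ℕ} (hbar ε₀ : ℝ) {m g₀ : ℝ} (lam μ : ℝ) (hm : 0 < m)
    (hg₀ : 0 < g₀) {θ : ℝ} (hθ : 0 ≤ θ) {α : ℝ} (hα : α ≤ 0) :
    (μ - α) ^ 2 / (2 * lam) ≤ bzPressure d hbar m ε₀ g₀ θ α + (μ - α) ^ 2 / (2 * lam) := by
  have h1 := perfectPressure_nonneg (d := d) hbar hm hθ hα
  have h2 : 0 ≤ condensatePressure g₀ (α - ε₀) := by unfold condensatePressure; positivity
  rw [bzPressure_eq d hbar m ε₀ θ α hg₀]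
  linarith

theorem toyPressure_le {d : ℕ} (hbar ε₀ : ℝ) {m g₀ lam : ℝ} (μ : ℝ) (hm : 0 < m)
    (hg₀ : 0 < g₀) (hlam : 0 < lam) {θ : ℝ} (hθ : 0 ≤ θ) {α : ℝ} (hα : α ≤ 0) :
    toyPressure d hbar m ε₀ g₀ lam θ μ
      ≤ bzPressure d hbar m ε₀ g₀ θ α + (μ - α) ^ 2 / (2 * lam) := by
  refine ciInf_le ⟨0, ?_⟩ (⟨α, hα⟩ : Set.Iic (0 : ℝ))
  rintro _ ⟨a, rfl⟩
  exact le_trans (by positivity) (sq_div_le_variational hbar ε₀ lam μ hm hg₀ hθ a.2)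

/-- The two bounds meet at the infimum. The lower one need not be applied at a minimizer: any `α <
0` with small `α f'(α)` gives at least `f(α) - α f'(α)`, up to an arbitrarily small error. -/
theorem tendsto_pressure_toyHamiltonian {d : ℕ} (hd : 2 < d) {hbar m ε₀ g₀ lam g : ℝ}
    (hhbar : 0 < hbar) (hm : 0 < m) (hlam : 0 < lam) (hg₀ : 0 < g₀) (hε₀ : ε₀ < 0) (hg : 0 < g)
    {θ : ℝ} (hθ : 0 ≤ θ) (μ : ℝ) :
    Tendsto (fun L : ℝ => pressure θ L μ (toyHamiltonian d hbar m ε₀ g₀ lam g L)) atTop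
      (𝓝 ((toyPressure d hbar m ε₀ g₀ lam θ μ : ℝ) : EReal)) := by
  rw [tendsto_order]
  constructor
  · intro a ha
    obtain ⟨y, hay, hy⟩ := EReal.lt_iff_exists_real_btwn.mp ha
    rw [EReal.coe_lt_coe_iff] at hy
    choose! ρ hρ0 hρ using fun α (hα : α < 0) =>
      exists_hasDerivAt_perfectPressure hd hhbar hm hθ hα
    have hder : ∀ α < 0, HasDerivAt
        (fun α => bzPressure d hbar m ε₀ g₀ θ α + (μ - α) ^ 2 / (2 * lam))
        (ρ α + max (α - ε₀) 0 / g₀ - (μ - α) / lam) α := by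
      intro α hα
      have h1 : HasDerivAt (fun α => condensatePressure g₀ (α - ε₀)) (max (α - ε₀) 0 / g₀) α := by
        have := (hasDerivAt_condensatePressure hg₀ (α - ε₀)).comp α
          ((hasDerivAt_id α).sub_const ε₀)
        simpa using! this
      have h2 : HasDerivAt (fun α => (μ - α) ^ 2 / (2 * lam)) (-((μ - α) / lam)) α := by
        have h3 := (((hasDerivAt_id α).const_sub μ).pow 2).div_const (2 * lam)
        have h4 : -((μ - α) / lam) = ((2 : ℕ) * (μ - id α) ^ (2 - 1) * -1) / (2 * lam) := by
          simp only [id]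
          field_simp
          push_cast
          ring
        rw [h4]
        exact h3
      simp_rw [bzPressure_eq d hbar m ε₀ θ _ hg₀]
      rw [sub_eq_add_neg]
      exact ((hρ α hα).add h1).add h2
    obtain ⟨α, hα, hs1, hs2⟩ := exists_small_slope hlam hder
      (fun α hα => sq_div_le_variational hbar ε₀ lam μ hm hg₀ hθ hα.le)
      (fun α hα => by
        have h1 := hρ0 α hα
        have h2 : 0 ≤ max (α - ε₀) 0 / g₀ := div_nonneg (le_max_right _ _) hg₀.le
        rw [neg_div]
        linarith) (sub_pos.mpr hy)
    have hinf := toyPressure_le (d := d) hbar ε₀ μ hm hg₀ hlam hθ hα.le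
    -- The density `R = (μ-α)/λ` maximizes `(μ-α)R - λR²/2`. The excess is then minus the slope at
    -- `α`, nonnegative by the choice of `α`.
    have hev := eventually_le_pressure_toy hd (μ := μ) (lam := lam) (y := y) hhbar hm hε₀ hg₀ hg
      hθ hα (hρ α hα) (c := -(ρ α + max (α - ε₀) 0 / g₀ - (μ - α) / lam)) (by linarith)
      (R := (μ - α) / lam) (by ring) (by
        rw [bzPressure_eq d hbar m ε₀ θ α hg₀] at hinf
        set s := ρ α + max (α - ε₀) 0 / g₀ - (μ - α) / lam
        have e : -α * ((μ - α) / lam) + μ * ((μ - α) / lam) - lam * ((μ - α) / lam) ^ 2 / 2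
            = (μ - α) ^ 2 / (2 * lam) := by
          field_simp
          ring
        linarith)
    exact hev.mono fun L hL => hay.trans_le hL
  · intro a ha
    obtain ⟨y, hy, hya⟩ := EReal.lt_iff_exists_real_btwn.mp ha
    rw [EReal.coe_lt_coe_iff] at hy
    obtain ⟨α, hα⟩ := exists_lt_of_ciInf_lt hy
    have hadm : AdmissibleCouplings (d := d) fun _ _ => g / 2 :=
      ⟨g / 2, g / 2, 0, 1, fun _ => g / 2, fun _ => 0, by positivity, by norm_num, by norm_num,
        fun k _ => ⟨by positivity, le_rfl, le_rfl, fun V _ => ⟨le_rfl, by simp⟩⟩⟩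
    have h1 := tendsto_pressure_bzHamiltonian hd (ε₀ := ε₀) hhbar hm hg₀ hadm hθ
      (show (α : ℝ) ≤ 0 from α.2)
    have h2 : ((bzPressure d hbar m ε₀ g₀ θ α : ℝ) : EReal)
        < ((y - (μ - α) ^ 2 / (2 * lam) : ℝ) : EReal) := by
      rw [EReal.coe_lt_coe_iff]
      linarith
    filter_upwards [h1.eventually (gt_mem_nhds h2), eventually_gt_atTop 0] with L h3 hL
    refine lt_of_le_of_lt (pressure_toy_le hbar m ε₀ μ α hg₀ hg hlam hθ hL) (lt_of_le_of_lt ?_ hya)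
    refine (add_le_add_left h3.le _).trans (le_of_eq ?_)
    rw [← EReal.coe_add, sub_add_cancel]

end BoseToy

theorem mainTheorem10 (d : ℕ) (hd : 2 < d) (hbar m ε₀ g₀ lam : ℝ) (hhbar : 0 < hbar) (hm : 0 < m)
    (hlam : 0 < lam) (hg₀ : 0 < g₀) (hε₀ : ε₀ < 0) :
    -- superstability `H ≥ -B N + (C/V) N²`, with `B = -ε₀` and `C = lam/2`
    (∀ g : ℝ, 0 < g → ∀ L : ℝ, 0 < L → ∀ ψ : BoseToy.Core d,
      ε₀ * BoseToy.quadForm (BoseToy.totalNumber d) ψ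
          + (lam / 2) / L ^ d * BoseToy.quadForm (BoseToy.totalNumber d ^ 2) ψ
        ≤ BoseToy.quadForm (BoseToy.toyHamiltonian d hbar m ε₀ g₀ lam g L) ψ) ∧
    -- the domain of stability
    (∀ g : ℝ, 0 < g →
      BoseToy.stabilityDomain d hbar m ε₀ g₀ lam g = Set.Ici (0 : ℝ) ×ˢ (Set.univ : Set ℝ)) ∧
    -- `bzPressure` is the thermodynamic limit of the pressure of the model `H^BZ`
    (∀ gk : BoseToy.Mode d → ℝ → ℝ, BoseToy.AdmissibleCouplings gk →
      ∀ θ : ℝ, 0 ≤ θ → ∀ α : ℝ, α ≤ 0 →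
        Filter.Tendsto
          (fun L : ℝ => BoseToy.pressure θ L α (BoseToy.bzHamiltonian d hbar m ε₀ g₀ gk L))
          Filter.atTop (nhds ((BoseToy.bzPressure d hbar m ε₀ g₀ θ α : ℝ) : EReal))) ∧
    -- the limiting pressure of the toy model, independent of `g > 0`
    (∃ p : ℝ → ℝ → ℝ,
      (∀ g : ℝ, 0 < g → ∀ θ : ℝ, 0 ≤ θ → ∀ μ : ℝ,
        Filter.Tendsto
          (fun L : ℝ => BoseToy.pressure θ L μ (BoseToy.toyHamiltonian d hbar m ε₀ g₀ lam g L))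
          Filter.atTop (nhds ((p θ μ : ℝ) : EReal))) ∧
      (∀ θ : ℝ, 0 ≤ θ → ∀ μ : ℝ,
        p θ μ = ⨅ α : Set.Iic (0 : ℝ),
          (BoseToy.bzPressure d hbar m ε₀ g₀ θ (α : ℝ) + (μ - (α : ℝ)) ^ 2 / (2 * lam)))) := by
  refine ⟨fun g hg L hL ψ => BoseToy.toyHamiltonian_superstable d hbar lam hm hε₀ hg₀ hg hL ψ,
    fun g hg => ?_,
    fun gk hgk θ hθ α hα => BoseToy.tendsto_pressure_bzHamiltonian hd hhbar hm hg₀ hgk hθ hα,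
    BoseToy.toyPressure d hbar m ε₀ g₀ lam,
    fun g hg θ hθ μ =>
      BoseToy.tendsto_pressure_toyHamiltonian hd hhbar hm hlam hg₀ hε₀ hg hθ μ,
    fun θ _ μ => rfl⟩
  ext ⟨θ, μ⟩
  refine ⟨fun h => ⟨h.1, trivial⟩, fun h => ⟨h.1, _, EReal.coe_lt_top _,
    BoseToy.tendsto_pressure_toyHamiltonian hd hhbar hm hlam hg₀ hε₀ hg h.1 μ⟩⟩
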